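/- **Setting.** Validators $V_1,\dots,V_N$ ($N\ge 1$) have fixed stakes $w(V)>0$ with $\sum_V w(V)=N$. Time is divided into slots, and $C\ge 1$ consecutive slots, where $C\mid N$, form an epoch: $\mathsf{ep}(i)=\lfloor i/C\rfloor$. For each epoch $j$ a permutation $\rho_j$ of $\{0,\dots,N-1\}$ is given; the committee of slot $jC+k$ ($0\le k<C$) consists of the validators with index $\rho_j(s)$, $s\equiv k \pmod C$, and the validator with index $\rho_j(k)$ is the proposer of the slot. *Messages* are blocks and attestations. A block $B$ other than the genesis block (slot $0$) is signed by the proposer of its slot and contains $\mathsf{slot}(B)$, a parent of smaller slot, a set of newly included attestations, and arbitrary data; it depends on its parent and on these attestations. An attestation $\alpha$ contains its author, a slot, and a block $\mathsf{block}(\alpha)$ of slot at most $\mathsf{slot}(\alpha)$, on which it depends, and a checkpoint edge $\mathsf{LJ}(\alpha)\to\mathsf{LE}(\alpha)$ defined below. A *view* is a finite set of messages closed under dependencies; $\mathsf{view}(B)$ is $B$ with all its ancestors in the dependency graph; $\mathsf{chain}(B)$ is the chain of parents from genesis to $B$. $\mathsf{EBB}(B,j)$ is the block of highest slot $\le jC$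 in $\mathsf{chain}(B)$, $\mathsf{LEBB}(B)=\mathsf{EBB}(B,\mathsf{ep}(\mathsf{slot}(B)))$ and $\mathsf{ffgview}(B)=\mathsf{view}(\mathsf{LEBB}(B))$. In a view $G$ there is a *supermajority link* $(A,j')\to(B,j)$ if the validators with an attestation in $G$ with this checkpoint edge have total stake more than $2N/3$. $J(G)$, the set of *justified* pairs, is the smallest set that contains $(B_{\rm genesis},0)$ and is closed under following supermajority links. $\mathsf{LJ}(B)$ is the pair of highest epoch in $J(\mathsf{ffgview}(B))$; for an attestation, $\mathsf{LJ}(\alpha)=\mathsf{LJ}(\mathsf{block}(\alpha))$ and $\mathsf{LE}(\alpha)=(\mathsf{LEBB}(\mathsf{block}(\alpha)),\mathsf{ep}(\mathsf{slot}(\alpha)))$. A pair $(B_0,j)$ is *$k$-finalized* in $G$ ($k\ge1$) if there are blocks $B_1,\dots,B_k$ in $G$ with $B_i=\mathsf{EBB}(B_k,j+i)$ for $0\le i\le k$, $(B_i,j+i)\in J(G)$ for $0\le i<k$, and a supermajority link $(B_0,j)\to(B_k,j+k)$ in $G$; it is *finalized* if it is $(B_{\rm genesis},0)$ or is $k$-finalized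 for some $k$. $\mathsf{chain}(B)$ is *stable at $j$* if $\mathsf{LJ}(\mathsf{EBB}(B,j))=(B',j-1)$ for some block $B'$. The *head* $\mathsf{HLMD}(G)$ of a view $G$ is computed as follows: let $(B_J,j)$ be the pair of highest epoch in $\bigcup_l J(\mathsf{ffgview}(l))$ over the leaf blocks $l$ of $G$; let $G'$ be the union of the chains of those leaf blocks $l$ with $(B_J,j)\in J(\mathsf{ffgview}(l))$; start at $B_J$ and move repeatedly to the child in $G'$ for which the validators whose most recent attestation in $G$ is to this child or a descendant of it have the largest total stake, until there is no child in $G'$. All ties are broken by a collision-free hash of blocks. *Protocol.* At the beginning of each slot $i\ge1$ its proposer proposes a block of slot $i$ whose parent is the head of the proposer's view and which includes exactly the attestations of this view that no ancestor includes; in the middle of the slot every member of its committee attests to the head of his view. The author of a message adds it to his view at once. The network is asynchronous: a broadcast message reaches another validator after an arbitrary delay or never, and it is not accepted before its slot or before its dependencies. Validators who are not honest may broadcast any messages of their own. **Theorem (Plausible liveness).** Suppose that the honest validators have total stake at least $2N/3$. Consider any possible state of the blockchain, at any time, no matter what has happened before; let $i$ be the current slot. Then there is an execution that continues from this state, in which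 the honest validators follow the protocol and a new block is finalized. More precisely, there are an epoch $e$ with $i<eC\le i+2C$ and a block $B$ with slot $eC$, not among the messages broadcast so far, such that in this execution, by the end of slot $eC$, $B$ is the head of the chain in the view of every honest validator and $\mathsf{chain}(B)$ is stable at $e$; and at the beginning of slot $(e+2)C$, every honest validator sees that $(B,e)$ is finalized, namely $1$-finalized. Moreover, for every set $A$ of validators that contains all honest ones and has total stake more than $2N/3$ (the set of honest validators itself if its stake exceeds $2N/3$, otherwise any larger set), and that contains the proposers of the first slots of the next three epochs, there is such an execution in which the validators outside $A$ broadcast nothing. -/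

import Mathlib

namespace Gasper

/-! ### Messages -/

mutual

/-- Blocks. A non-genesis block carries the signature of its author, its slot number, a pointer to
its parent, pointers to the attestations it newly includes, and implementation-specific data. -/
inductive Block (N : ℕ) : Type
  | genesis : Block N
  | mk (author : Fin N) (slot : ℕ) (parent : Block N) (newattests : List (Attestation N))
      (data : ℕ) : Block N

/-- Attestations. Besides its author, its slot and the block it attests to, an attestation contains
a checkpoint edge, from the pair `(srcBlock, srcEpoch)` to the pair `(tgtBlock, tgtEpoch)`. -/
inductive Attestation (N : ℕ) : Type
  | mk (author : Fin N) (slot : ℕ) (block : Block N)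
      (srcBlock : Block N) (srcEpoch : ℕ) (tgtBlock : Block N) (tgtEpoch : ℕ) : Attestation N

end

/-- Pairs `(B, j)` of a block and an (attestation) epoch. -/
abbrev Pair (N : ℕ) : Type := Block N × ℕ

/-- A message is a block or an attestation. -/
inductive Msg (N : ℕ) : Type
  | block (B : Block N) : Msg N
  | att (α : Attestation N) : Msg N

namespace Attestation

variable {N : ℕ}

def author : Attestation N → Fin N
  | mk v _ _ _ _ _ _ => v

def slot : Attestation N → ℕ
  | mk _ i _ _ _ _ _ => i

/-- The block that is attested to. -/
def block : Attestation N → Block N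
  | mk _ _ B _ _ _ _ => B

/-- The source of the checkpoint edge. -/
def source : Attestation N → Pair N
  | mk _ _ _ A a _ _ => (A, a)

/-- The target of the checkpoint edge. -/
def target : Attestation N → Pair N
  | mk _ _ _ _ _ B b => (B, b)

end Attestation

namespace Block

variable {N : ℕ}

def author : Block N → Option (Fin N)
  | genesis => none
  | mk v _ _ _ _ => some v

def slot : Block N → ℕ
  | genesis => 0
  | mk _ i _ _ _ => i

def parent : Block N → Option (Block N)
  | genesis => none
  | mk _ _ p _ _ => some p

def newattests : Block N → List (Attestation N)
  | genesis => []
  | mk _ _ _ l _ => l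

/-- The chain of `B`, listed from `B` back to the genesis block. `A ∈ B.chain` says that `B` is `A`
or a descendant of `A`. -/
def chain : Block N → List (Block N)
  | genesis => [genesis]
  | mk v i p l d => mk v i p l d :: chain p

/-- The block with the highest slot `≤ n` in the chain of `B`. (Slots increase strictly along the
chain of a valid block, so it is the first such block on the way back to genesis.) -/
def lastUpTo (n : ℕ) : Block N → Block N
  | genesis => genesis
  | mk v i p l d => if i ≤ n then mk v i p l d else lastUpTo n p

end Block

namespace Msg

variable {N : ℕ}

def author : Msg N → Option (Fin N)
  | block B => B.author
  | att α => some α.author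

/-- The timestamp of a message. -/
def slot : Msg N → ℕ
  | block B => B.slot
  | att α => α.slot

/-- `Dep m m'`: the message `m'` depends (directly) on the message `m`. A block depends on its
parent and on the attestations it includes, an attestation on the block it attests to. -/
inductive Dep : Msg N → Msg N → Prop
  | parent {B p : Block N} : B.parent = some p → Dep (block p) (block B)
  | newattest {B : Block N} {α : Attestation N} : α ∈ B.newattests → Dep (att α) (block B)
  | attested (α : Attestation N) : Dep (block α.block) (att α)

end Msg

/-- The view of a block: the block and all its ancestors in the dependency graph. -/
def viewOf {N : ℕ} (B : Block N) : Set (Msg N) :=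
  {m | Relation.ReflTransGen Msg.Dep m (Msg.block B)}

open Classical in
/-- The element of `S` with the largest key (`d` if there is none). -/
noncomputable def argmax {α β : Type*} [LE β] (S : Set α) (key : α → β) (d : α) : α :=
  if h : ∃ a ∈ S, ∀ b ∈ S, key b ≤ key a then h.choose else d

/-! ### Parameters of the protocol -/

/-- The fixed data of a blockchain with `N` validators: the number `C` of slots per epoch, the
stakes (of average `1`), the shuffling of the validators in each epoch, and a collision-free hash
that breaks ties. -/
structure Params (N : ℕ) where
  C : ℕ
  N_pos : 0 < N
  C_pos : 0 < C
  C_dvd : C ∣ N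
  stake : Fin N → ℝ
  stake_pos : ∀ v, 0 < stake v
  stake_sum : ∑ v, stake v = N
  ρ : ℕ → Equiv.Perm (Fin N)
  hash : Block N ↪ ℕ

namespace Params

variable {N : ℕ} (P : Params N)

/-- The epoch of a slot. -/
def ep (i : ℕ) : ℕ := i / P.C

/-- The committee of slot `i = jC + k`: the validators `ρ_j(s)` with `s ≡ k mod C`. -/
def committee (i : ℕ) : Set (Fin N) :=
  {v | ∃ s : Fin N, (s : ℕ) % P.C = i % P.C ∧ v = P.ρ (P.ep i) s}

/-- The proposer of slot `i = jC + k`: the first member `ρ_j(k)` of its committee. -/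
def proposer (i : ℕ) : Fin N :=
  P.ρ (P.ep i)
    ⟨i % P.C, (Nat.mod_lt i P.C_pos).trans_le (Nat.le_of_dvd P.N_pos P.C_dvd)⟩

/-! ### Epoch boundary blocks, justification, finalization -/

/-- The `j`-th epoch boundary block of `B`. -/
def EBB (B : Block N) (j : ℕ) : Block N := B.lastUpTo (j * P.C)

/-- The last epoch boundary block of `B`. -/
def LEBB (B : Block N) : Block N := P.EBB B (P.ep B.slot)

/-- The FFG view of `B`. -/
def ffgview (B : Block N) : Set (Msg N) := viewOf (P.LEBB B)

open Classical in
/-- The total stake of the validators with an attestation in `G` for the checkpoint edge from `p`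
to `q`. -/
noncomputable def linkWeight (G : Set (Msg N)) (p q : Pair N) : ℝ :=
  ∑ v with ∃ α, Msg.att α ∈ G ∧ α.author = v ∧ α.source = p ∧ α.target = q, P.stake v

/-- There is a supermajority link from `p` to `q` in `G`: more than `2/3` of the total stake. -/
def SupermajorityLink (G : Set (Msg N)) (p q : Pair N) : Prop :=
  2 * (N : ℝ) / 3 < P.linkWeight G p q

/-- `Justified P G p`: the pair `p` is justified in `G`, that is, `p ∈ J(G)`. -/
inductive Justified (G : Set (Msg N)) : Pair N → Prop
  | genesis : Justified G (Block.genesis, 0)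
  | link {p q : Pair N} : Justified G p → P.SupermajorityLink G p q → Justified G q

/-- The pair with the highest attestation epoch in a set of pairs (ties are broken by hash). -/
noncomputable def lastPair (S : Set (Pair N)) : Pair N :=
  argmax S (fun p => toLex (p.2, P.hash p.1)) (Block.genesis, 0)

/-- The last justified pair of a block `B`: the last justified pair in the FFG view of `B`. -/
noncomputable def LJ (B : Block N) : Pair N := P.lastPair {p | P.Justified (P.ffgview B) p}

/-- The chain of `B` is stable at the epoch `j`. -/
def StableAt (B : Block N) (j : ℕ) : Prop :=
  ∃ (B' : Block N) (i : ℕ), i + 1 = j ∧ P.LJ (P.EBB B j) = (B', i)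

/-- The pair `p = (B₀, j)` is `k`-finalized in `G` (`k ≥ 1`): there are blocks `B₁, …, B_k` in `G`
such that `(B₀, j), …, (B_k, j + k)` are adjacent epoch boundary pairs in the chain of `B_k`, all
but the last are justified in `G`, and there is a supermajority link from the first to the last. -/
def KFinalized (G : Set (Msg N)) (k : ℕ) (p : Pair N) : Prop :=
  1 ≤ k ∧ ∃ B : ℕ → Block N, B 0 = p.1 ∧
    (∀ i, 1 ≤ i → i ≤ k → Msg.block (B i) ∈ G) ∧
    (∀ i ≤ k, P.EBB (B k) (p.2 + i) = B i) ∧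
    (∀ i < k, P.Justified G (B i, p.2 + i)) ∧
    P.SupermajorityLink G p (B k, p.2 + k)

/-- `Finalized P G p`: the pair `p` is finalized in `G`, that is, `p ∈ F(G)`. -/
def Finalized (G : Set (Msg N)) (p : Pair N) : Prop :=
  p = (Block.genesis, 0) ∨ ∃ k, P.KFinalized G k p

/-! ### Valid messages and views -/

/-- The attestation that `v` writes in slot `i` when attesting to `B`. -/
noncomputable def attestation (v : Fin N) (i : ℕ) (B : Block N) : Attestation N :=
  .mk v i B (P.LJ B).1 (P.LJ B).2 (P.LEBB B) (P.ep i)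

/-- Valid messages. A block is newer than its parent and signed by the proposer of its slot. An
attestation is not older than the block it attests to, and its checkpoint edge leads from the last
justified pair of that block to its last epoch boundary pair. -/
def Valid : Msg N → Prop
  | .block B => ∀ p, B.parent = some p → p.slot < B.slot ∧ B.author = some (P.proposer B.slot)
  | .att α => α.block.slot ≤ α.slot ∧ α = P.attestation α.author α.slot α.block

/-- A set of accepted messages: only valid messages, each of them together with all its
dependencies. -/
def IsView (G : Finset (Msg N)) : Prop :=
  (∀ m ∈ G, P.Valid m) ∧ ∀ m ∈ G, ∀ m', Msg.Dep m' m → m' ∈ G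

/-! ### The fork-choice rule -/

/-- The leaf blocks of `G`. -/
def leaves (G : Finset (Msg N)) : Set (Block N) :=
  {B | Msg.block B ∈ G ∧ ∀ B', Msg.block B' ∈ G → B'.parent ≠ some B}

/-- The last pair that is justified in the FFG view of some leaf block of `G`. -/
noncomputable def startPair (G : Finset (Msg N)) : Pair N :=
  P.lastPair {p | ∃ l ∈ leaves G, P.Justified (P.ffgview l) p}

/-- The blocks of the filtered tree: the union of the chains of those leaf blocks of `G` in whose
FFG view the starting pair is justified. -/
def filteredBlocks (G : Finset (Msg N)) : Set (Block N) :=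
  {B | ∃ l ∈ leaves G, P.Justified (P.ffgview l) (P.startPair G) ∧ B ∈ l.chain}

/-- `α` is the most recent attestation of its author in `G` (ties are broken by hash). -/
def IsLatest (G : Finset (Msg N)) (α : Attestation N) : Prop :=
  Msg.att α ∈ G ∧ ∀ β, Msg.att β ∈ G → β.author = α.author →
    toLex (β.slot, P.hash β.block) ≤ toLex (α.slot, P.hash α.block)

open Classical in
/-- The stake of the validators whose most recent attestation in `G` is to `B` or to a descendant
of `B`. -/
noncomputable def weight (G : Finset (Msg N)) (B : Block N) : ℝ :=
  ∑ v with ∃ α, P.IsLatest G α ∧ α.author = v ∧ B ∈ α.block.chain, P.stake v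

/-- One iteration of the loop: move from `B` to its heaviest child in the filtered tree (ties are
broken by hash), and stay at `B` if there is no child. -/
noncomputable def forkStep (G : Finset (Msg N)) (B : Block N) : Block N :=
  argmax {B' | B' ∈ P.filteredBlocks G ∧ B'.parent = some B}
    (fun B' => toLex (P.weight G B', P.hash B')) B

/-- The hybrid LMD GHOST fork-choice rule: the head of the chain in the view `G`. (The loop ends
after fewer iterations than there are messages in `G`.) -/
noncomputable def hlmd (G : Finset (Msg N)) : Block N :=
  (P.forkStep G)^[G.card] (P.startPair G).1

/-! ### The behaviour that the protocol prescribes -/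

/-- `B` is a block that the protocol allows `v` to propose in slot `i` with the view `G`: its parent
is the head of the chain, and it includes exactly the attestations in `G` that no ancestor
includes. -/
def IsProposal (v : Fin N) (i : ℕ) (G : Finset (Msg N)) (B : Block N) : Prop :=
  B.author = some v ∧ B.slot = i ∧ B.parent = some (P.hlmd G) ∧
    ∀ α, α ∈ B.newattests ↔ Msg.att α ∈ G ∧ ∀ A ∈ (P.hlmd G).chain, α ∉ A.newattests

/-- The set `own` of messages is what `v` has to broadcast at time `t` with the view `G`. Time is
counted in half slots. At the beginning of slot `i ≥ 1` (time `2 * i`) the proposer of the slot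
proposes one block (the genesis block is the only block of slot `0`). In the middle of slot `i`
(time `2 * i + 1`) each member of the committee attests to the head of the chain. -/
def Prescribed (v : Fin N) (t : ℕ) (G own : Finset (Msg N)) : Prop :=
  (∀ i, t = 2 * i →
    ((1 ≤ i ∧ v = P.proposer i) → ∃ B, P.IsProposal v i G B ∧ own = {Msg.block B}) ∧
    (¬ (1 ≤ i ∧ v = P.proposer i) → own = ∅)) ∧
  (∀ i, t = 2 * i + 1 →
    (v ∈ P.committee i → own = {Msg.att (P.attestation v i (P.hlmd G))}) ∧
    (v ∉ P.committee i → own = ∅))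

end Params

/-! ### Executions -/

/-- A state of the blockchain: the time of the next events (in half slots), the messages that have
been broadcast so far, and the current view of each validator. -/
structure State (N : ℕ) where
  time : ℕ
  net : Finset (Msg N)
  view : Fin N → Finset (Msg N)

/-- The current slot. -/
def State.slot {N : ℕ} (s : State N) : ℕ := s.time / 2

/-- The initial state: everyone has just the genesis block. -/
def State.init (N : ℕ) : State N where
  time := 0
  net := {Msg.block Block.genesis}
  view := fun _ => {Msg.block Block.genesis}

namespace Params

variable {N : ℕ} (P : Params N)

/-- The rules of the (asynchronous) network: when the messages in `sent` are broadcast, each view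
may grow by any broadcast messages that can be accepted and are not from a future slot. -/
structure NetworkStep (sent : Finset (Msg N)) (s s' : State N) : Prop where
  time_eq : s'.time = s.time + 1
  net_eq : ∀ m, m ∈ s'.net ↔ m ∈ s.net ∨ m ∈ sent
  view_mono : ∀ v, s.view v ⊆ s'.view v
  view_net : ∀ v, s'.view v ⊆ s'.net
  view_isView : ∀ v, P.IsView (s'.view v)
  view_slot : ∀ v, ∀ m ∈ s'.view v, m.slot ≤ s.slot

/-- The validator `v` follows the protocol: having received some (possibly no) messages from the
network, `v` has the view `G`, broadcasts what the protocol prescribes for this view and nothing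
else, and adds it to the view immediately. -/
def Follows (v : Fin N) (sent : Finset (Msg N)) (s s' : State N) : Prop :=
  ∃ G own : Finset (Msg N), s.view v ⊆ G ∧ G ⊆ s.net ∧ P.IsView G ∧
    P.Prescribed v s.time G own ∧
    (∀ m, m ∈ own ↔ m ∈ sent ∧ m.author = some v) ∧
    (∀ m, m ∈ s'.view v ↔ m ∈ G ∨ m ∈ own)

/-- One step of an execution in which the validators in `H` follow the protocol, the validators in
`A` not in `H` behave arbitrarily, and the validators outside `A` and `H` send nothing. -/
def Step (H A : Finset (Fin N)) (s s' : State N) : Prop :=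
  ∃ sent : Finset (Msg N), P.NetworkStep sent s s' ∧
    (∀ v ∈ H, P.Follows v sent s s') ∧
    ∀ m ∈ sent, ∀ v, m.author = some v → v ∈ H ∨ v ∈ A

/-- There is an execution, with `H` and `A` as above, from the state `s` to the state `s'`. -/
def Execution (H A : Finset (Fin N)) : State N → State N → Prop :=
  Relation.ReflTransGen (P.Step H A)

/-- `s` is a possible state of the blockchain, whatever anybody has done so far. -/
def Possible (s : State N) : Prop := P.Execution ∅ Finset.univ (State.init N) s

/-- There is an execution from `s` in which the validators in `H` follow the protocol, those outside
`A` and `H` send nothing, and the following happens. Within two epochs, at the beginning of an epoch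
`e`, a new block `B` is proposed; by the end of its slot `B` is the head of the chain for
everyone in `H`, and this chain is stable at `e`. When the epoch `e + 1` is over, everyone in `H`
sees that `(B, e)` is finalized, namely `1`-finalized. -/
def CanFinalize (H A : Finset (Fin N)) (s : State N) : Prop :=
  ∃ (s₁ s₂ : State N) (e : ℕ) (B : Block N),
    P.Execution H A s s₁ ∧ P.Execution H A s₁ s₂ ∧
    Msg.block B ∉ s.net ∧ B.slot = e * P.C ∧
    s.slot < e * P.C ∧ e * P.C ≤ s.slot + 2 * P.C ∧
    s₁.time ≤ 2 * (e * P.C) + 2 ∧ (∀ v ∈ H, P.hlmd (s₁.view v) = B) ∧ P.StableAt B e ∧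
    s₂.time ≤ 2 * ((e + 2) * P.C) + 1 ∧
    ∀ v ∈ H, P.KFinalized (s₂.view v) 1 (B, e) ∧ P.Finalized (s₂.view v) (B, e)

end Params

end Gasper

namespace Gasper

variable {N : ℕ}

/-! ### Chains of blocks -/

namespace Block

-- Three consecutive epochs of perfect communication suffice. Let the validators of `A` pool
-- everything that any validator has seen and then receive each other's messages before every event,
-- so that they all act on one common view (`IsRun`). Each of them sits on some committee in every
-- epoch. Hence, if the head stays among blocks with the same checkpoint edge throughout an epoch,
-- that edge becomes a supermajority link, and its target is justified if its source is
-- (`IsRun.epochVotes`).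
--
-- Let `Z` be the block proposed at the start of an epoch with the common view `U`. Together with
-- its ancestors it includes every attestation in `U`, so its FFG view justifies exactly what `U`
-- justifies (`ProposedOn.justified_iff`). Let `X` be the block of `LJ Z`. If `X` is in the chain of
-- `Z`, the head stays above `Z` for the whole epoch: a rival branch passes the filter only if the
-- fork choice in `U` already started at `X`, and there the chain of `Z` had won
-- (`Extends.onBranch_hlmd`). If `X` is not in the chain of `Z`, then no leaf above `X` sees the
-- pair as justified, and `X` itself is the head for the whole epoch (`Extends.hlmd_eq_of_not_mem`).
-- In both cases everyone votes for the same edge.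
--
-- So the first epoch justifies a pair `(T, k)` with `T` below the head, and no justified pair has a
-- higher epoch. The next boundary block `B` therefore has `LJ B = (T, k)` with `T` in its chain; it
-- is stable, and the good case applies to it. The same holds for the boundary block `B'` after
-- that, with `LJ B' = (B, k + 1)`, and the votes of its epoch finalize `B`.

theorem parent_induction {motive : Block N → Prop} (genesis : motive .genesis)
    (mk : ∀ v i p l d, motive p → motive (.mk v i p l d)) : ∀ B, motive B
  | .genesis => genesis
  | .mk v i p l d => mk v i p l d (parent_induction genesis mk p)

theorem mem_chain_self (B : Block N) : B ∈ B.chain := by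
  cases B <;> simp [chain]

theorem genesis_mem_chain (B : Block N) : genesis ∈ B.chain := by
  induction B using parent_induction <;> simp_all [chain]

theorem chain_of_parent {B p : Block N} (h : B.parent = some p) : B.chain = B :: p.chain := by
  cases B <;> simp_all [chain, parent]

theorem mem_chain_of_parent {A B p : Block N} (h : B.parent = some p) :
    A ∈ B.chain ↔ A = B ∨ A ∈ p.chain := by
  simp [chain_of_parent h]

theorem chain_trans {A B D : Block N} (h : A ∈ B.chain) (h' : B ∈ D.chain) : A ∈ D.chain := by
  induction D using parent_induction with
  | genesis => simp_all [chain]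
  | mk v i p l d ih =>
    simp only [chain, List.mem_cons] at h'
    rcases h' with rfl | h'
    · exact h
    · exact List.mem_cons_of_mem _ (ih h')

/-- Structural size measures progress along chains for arbitrary blocks, whereas slots increase only
along chains of valid ones. -/
theorem sizeOf_lt_of_parent {B p : Block N} (h : B.parent = some p) : sizeOf p < sizeOf B := by
  cases B <;> simp_all [parent]
  omega

theorem sizeOf_le_of_mem_chain {A B : Block N} (h : A ∈ B.chain) : sizeOf A ≤ sizeOf B := by
  induction B using parent_induction with
  | genesis => simp_all [chain]
  | mk v i p l d ih =>
    simp only [chain, List.mem_cons] at h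
    rcases h with rfl | h
    · exact le_rfl
    · exact (ih h).trans (sizeOf_lt_of_parent rfl).le

theorem chain_nodup (B : Block N) : B.chain.Nodup := by
  induction B using parent_induction with
  | genesis => simp [chain]
  | mk v i p l d ih =>
    refine List.nodup_cons.2 ⟨fun h => ?_, ih⟩
    exact absurd (sizeOf_le_of_mem_chain h) (sizeOf_lt_of_parent rfl).not_ge

theorem chain_antisymm {A B : Block N} (h : A ∈ B.chain) (h' : B ∈ A.chain) : A = B := by
  cases B with
  | genesis => simpa [chain] using h
  | mk v i p l d =>
    rcases (mem_chain_of_parent rfl).1 h with h | h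
    · exact h
    · have h1 := sizeOf_le_of_mem_chain h
      have h2 := sizeOf_le_of_mem_chain h'
      have h3 := sizeOf_lt_of_parent (B := mk v i p l d) rfl
      omega

/-- A chain is a path, so it passes through at most one child of a block. This separates a branch
from its rivals in the fork choice. -/
theorem eq_of_mem_chain_of_parent_eq {A A' B q : Block N} (h : A ∈ B.chain) (h' : A' ∈ B.chain)
    (hA : A.parent = some q) (hA' : A'.parent = some q) : A = A' := by
  induction B using parent_induction with
  | genesis => simp_all [chain]
  | mk v i p l d ih =>
    rcases (mem_chain_of_parent rfl).1 h with h | h <;>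
      rcases (mem_chain_of_parent rfl).1 h' with h' | h'
    · rw [h, h']
    · subst h
      obtain rfl : p = q := by simpa [parent] using hA
      exact absurd (sizeOf_le_of_mem_chain h') (sizeOf_lt_of_parent hA').not_ge
    · subst h'
      obtain rfl : p = q := by simpa [parent] using hA'
      exact absurd (sizeOf_le_of_mem_chain h) (sizeOf_lt_of_parent hA).not_ge
    · exact ih h h'

theorem lastUpTo_of_le {B : Block N} {n : ℕ} (h : B.slot ≤ n) : B.lastUpTo n = B := by
  cases B <;> simp_all [lastUpTo, slot]

theorem lastUpTo_of_parent {B p : Block N} {n : ℕ} (h : B.parent = some p) (hn : n < B.slot) :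
    B.lastUpTo n = p.lastUpTo n := by
  cases B with
  | genesis => simp [parent] at h
  | mk v i q l d =>
    obtain rfl : q = p := by simpa [parent] using h
    exact if_neg (not_le.2 hn)

theorem lastUpTo_mem_chain (B : Block N) (n : ℕ) : B.lastUpTo n ∈ B.chain := by
  induction B using parent_induction with
  | genesis => simp [chain, lastUpTo]
  | mk v i p l d ih =>
    unfold lastUpTo
    split_ifs
    · exact mem_chain_self _
    · exact List.mem_cons_of_mem _ ih

end Block

theorem Msg.block_injective : Function.Injective (Msg.block (N := N)) := fun _ _ h => by
  simpa using h

/-! ### Dependencies -/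

theorem Msg.Dep.sizeOf_lt {m m' : Msg N} (h : Msg.Dep m m') : sizeOf m < sizeOf m' := by
  cases h with
  | parent h => simpa using Block.sizeOf_lt_of_parent h
  | @newattest B α h =>
    cases B with
    | genesis => simp [Block.newattests] at h
    | mk v i p l d =>
      have := List.sizeOf_lt_of_mem (show α ∈ l from h)
      simp
      omega
  | attested α =>
    cases α
    simp [Attestation.block]
    omega

theorem sizeOf_le_of_mem_viewOf {m : Msg N} {B : Block N} (h : m ∈ viewOf B) :
    sizeOf m ≤ sizeOf (Msg.block B) := by
  induction (show Relation.ReflTransGen Msg.Dep m (Msg.block B) from h)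
    using Relation.ReflTransGen.head_induction_on with
  | refl => exact le_rfl
  | head hd hr ih => exact hd.sizeOf_lt.le.trans (ih hr)

theorem block_mem_viewOf_of_mem_chain {A B : Block N} (h : A ∈ B.chain) :
    Msg.block A ∈ viewOf B := by
  induction B using Block.parent_induction with
  | genesis =>
    obtain rfl : A = .genesis := by simpa [Block.chain] using h
    exact .refl
  | mk v i p l d ih =>
    rcases (Block.mem_chain_of_parent rfl).1 h with rfl | h
    · exact .refl
    · exact (ih h).tail (.parent rfl)

theorem viewOf_subset_of_mem_chain {A B : Block N} (h : A ∈ B.chain) : viewOf A ⊆ viewOf B :=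
  fun _ hm => Relation.ReflTransGen.trans hm (block_mem_viewOf_of_mem_chain h)

theorem att_mem_viewOf {A B : Block N} {α : Attestation N} (h : A ∈ B.chain)
    (hα : α ∈ A.newattests) : Msg.att α ∈ viewOf B :=
  .head (.newattest hα) (block_mem_viewOf_of_mem_chain h)

/-! ### Largest elements -/

theorem argmax_spec {α β : Type*} [LE β] {S : Set α} {key : α → β} {d : α}
    (h : ∃ a ∈ S, ∀ b ∈ S, key b ≤ key a) :
    argmax S key d ∈ S ∧ ∀ b ∈ S, key b ≤ key (argmax S key d) := by
  rw [argmax, dif_pos h]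
  exact h.choose_spec

theorem argmax_of_not {α β : Type*} [LE β] {S : Set α} {key : α → β} {d : α}
    (h : ¬ ∃ a ∈ S, ∀ b ∈ S, key b ≤ key a) : argmax S key d = d := dif_neg h

theorem argmax_eq {α β : Type*} [PartialOrder β] {S : Set α} {key : α → β} {d a : α}
    (hkey : Function.Injective key) (ha : a ∈ S) (h : ∀ b ∈ S, key b ≤ key a) :
    argmax S key d = a := by
  obtain ⟨h1, h2⟩ := argmax_spec (d := d) ⟨a, ha, h⟩
  exact hkey (le_antisymm (h _ h1) (h2 _ ha))

namespace Params

variable (P : Params N)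

theorem pairKey_injective :
    Function.Injective (fun p : Pair N => toLex (p.2, P.hash p.1)) := by
  rintro ⟨A, a⟩ ⟨B, b⟩ h
  simpa [and_comm] using h

theorem childKey_injective (G : Finset (Msg N)) :
    Function.Injective (fun B : Block N => toLex (P.weight G B, P.hash B)) := by
  intro A B h
  have : P.weight G A = P.weight G B ∧ A = B := by simpa using h
  exact this.2

theorem lastPair_spec {S : Set (Pair N)} (hS : S.Finite) (hne : S.Nonempty) :
    P.lastPair S ∈ S ∧
      ∀ q ∈ S, toLex (q.2, P.hash q.1) ≤ toLex ((P.lastPair S).2, P.hash (P.lastPair S).1) :=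
  argmax_spec (Set.exists_max_image S (fun p : Pair N => toLex (p.2, P.hash p.1)) hS hne)

theorem lastPair_eq {S : Set (Pair N)} {p : Pair N} (hp : p ∈ S)
    (h : ∀ q ∈ S, toLex (q.2, P.hash q.1) ≤ toLex (p.2, P.hash p.1)) : P.lastPair S = p :=
  argmax_eq P.pairKey_injective hp h

/-! ### Justification -/

theorem linkWeight_mono {G G' : Set (Msg N)} (h : ∀ α, Msg.att α ∈ G → Msg.att α ∈ G')
    (p q : Pair N) : P.linkWeight G p q ≤ P.linkWeight G' p q := by
  refine Finset.sum_le_sum_of_subset_of_nonneg ?_ fun v _ _ => (P.stake_pos v).le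
  intro v
  simp only [Finset.mem_filter, Finset.mem_univ, true_and]
  rintro ⟨α, hα, h'⟩
  exact ⟨α, h α hα, h'⟩

variable {P}

theorem SupermajorityLink.mono {G G' : Set (Msg N)} (h : ∀ α, Msg.att α ∈ G → Msg.att α ∈ G')
    {p q : Pair N} (hl : P.SupermajorityLink G p q) : P.SupermajorityLink G' p q :=
  lt_of_lt_of_le hl (P.linkWeight_mono h p q)

/-- Only attestations matter for justification. The weak hypothesis allows a comparison of `viewOf
Z` with a view that lacks the block `Z`. -/
theorem Justified.mono {G G' : Set (Msg N)} (h : ∀ α, Msg.att α ∈ G → Msg.att α ∈ G')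
    {p : Pair N} (hp : P.Justified G p) : P.Justified G' p := by
  induction hp with
  | genesis => exact .genesis
  | link _ hl ih => exact .link ih (hl.mono h)

theorem SupermajorityLink.exists_att {G : Set (Msg N)} {p q : Pair N}
    (h : P.SupermajorityLink G p q) : ∃ α, Msg.att α ∈ G ∧ α.target = q := by
  classical
  by_contra! hc
  have h0 : P.linkWeight G p q = 0 := by
    refine (Finset.sum_congr (Finset.filter_false_of_mem ?_) fun _ _ => rfl).trans
      Finset.sum_empty
    rintro v - ⟨α, hα, _, _, ht⟩
    exact hc α hα ht
  have : (0 : ℝ) ≤ 2 * (N : ℝ) / 3 := by positivity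
  rw [SupermajorityLink, h0] at h
  linarith

theorem Justified.eq_or_exists_att {G : Set (Msg N)} {p : Pair N} (h : P.Justified G p) :
    p = (Block.genesis, 0) ∨ ∃ α, Msg.att α ∈ G ∧ α.target = p := by
  cases h with
  | genesis => exact .inl rfl
  | link _ hl => exact .inr hl.exists_att

/-- Apart from the genesis pair, every justified pair is the target of an attestation. Finiteness
ensures that `lastPair` is a true maximum and not its default value. -/
theorem finite_justified {V : Set (Msg N)} (G : Finset (Msg N))
    (h : ∀ α, Msg.att α ∈ V → Msg.att α ∈ G) : {p | P.Justified V p}.Finite := by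
  let f : Msg N → Pair N := fun m => match m with
    | .block _ => (Block.genesis, 0)
    | .att α => α.target
  refine ((G.finite_toSet.image f).insert (Block.genesis, 0)).subset fun p hp => ?_
  rcases Justified.eq_or_exists_att hp with rfl | ⟨α, hα, rfl⟩
  · exact Set.mem_insert _ _
  · exact Set.mem_insert_of_mem _ ⟨Msg.att α, h α hα, rfl⟩

/-! ### Views -/

theorem IsView.viewOf_subset {G : Finset (Msg N)} (hG : P.IsView G) {B : Block N}
    (hB : Msg.block B ∈ G) {m : Msg N} (hm : m ∈ viewOf B) : m ∈ G := by
  induction (show Relation.ReflTransGen Msg.Dep m (Msg.block B) from hm)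
    using Relation.ReflTransGen.head_induction_on with
  | refl => exact hB
  | head h hr ih => exact hG.2 _ (ih hr) _ h

theorem IsView.mem_of_mem_chain {G : Finset (Msg N)} (hG : P.IsView G) {A B : Block N}
    (hB : Msg.block B ∈ G) (h : A ∈ B.chain) : Msg.block A ∈ G :=
  hG.viewOf_subset hB (block_mem_viewOf_of_mem_chain h)

theorem IsView.genesis_mem {G : Finset (Msg N)} (hG : P.IsView G) {B : Block N}
    (hB : Msg.block B ∈ G) : Msg.block Block.genesis ∈ G :=
  hG.mem_of_mem_chain hB B.genesis_mem_chain

theorem IsView.block_mem_of_att_mem {G : Finset (Msg N)} (hG : P.IsView G) {α : Attestation N}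
    (hα : Msg.att α ∈ G) : Msg.block α.block ∈ G :=
  hG.2 _ hα _ (.attested α)

theorem LEBB_mem_chain (B : Block N) : P.LEBB B ∈ B.chain := B.lastUpTo_mem_chain _

theorem IsView.ffgview_subset {G : Finset (Msg N)} (hG : P.IsView G) {B : Block N}
    (hB : Msg.block B ∈ G) {m : Msg N} (hm : m ∈ P.ffgview B) : m ∈ G :=
  hG.viewOf_subset hB (viewOf_subset_of_mem_chain (LEBB_mem_chain B) hm)

theorem IsView.target_eq {G : Finset (Msg N)} (hG : P.IsView G) {α : Attestation N}
    (hα : Msg.att α ∈ G) : α.target = (P.LEBB α.block, P.ep α.slot) := by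
  have h := (hG.1 _ hα).2
  conv_lhs => rw [h]
  rfl

theorem IsView.slot_lt_of_parent {G : Finset (Msg N)} (hG : P.IsView G) {B p : Block N}
    (hB : Msg.block B ∈ G) (hp : B.parent = some p) : p.slot < B.slot :=
  (hG.1 _ hB p hp).1

theorem IsView.slot_le_of_mem_chain {G : Finset (Msg N)} (hG : P.IsView G) {A B : Block N}
    (hB : Msg.block B ∈ G) (h : A ∈ B.chain) : A.slot ≤ B.slot := by
  induction B using Block.parent_induction with
  | genesis => simp_all [Block.chain]
  | mk v i p l d ih =>
    rcases (Block.mem_chain_of_parent rfl).1 h with rfl | h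
    · exact le_rfl
    · have hp : Msg.block p ∈ G := hG.2 _ hB _ (.parent rfl)
      exact (ih hp h).trans (hG.slot_lt_of_parent hB rfl).le

theorem IsView.lastUpTo_slot_eq {G : Finset (Msg N)} (hG : P.IsView G) {A B : Block N}
    (hB : Msg.block B ∈ G) (h : A ∈ B.chain) : B.lastUpTo A.slot = A := by
  induction B using Block.parent_induction with
  | genesis => simp_all [Block.chain, Block.lastUpTo]
  | mk v i p l d ih =>
    rcases (Block.mem_chain_of_parent rfl).1 h with rfl | h
    · exact Block.lastUpTo_of_le le_rfl
    · have hp : Msg.block p ∈ G := hG.2 _ hB _ (.parent rfl)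
      rw [Block.lastUpTo_of_parent rfl
        ((hG.slot_le_of_mem_chain hp h).trans_lt (hG.slot_lt_of_parent hB rfl))]
      exact ih hp h

theorem IsView.justified_block_mem {G : Finset (Msg N)} (hG : P.IsView G) {V : Set (Msg N)}
    (hV : ∀ m ∈ V, m ∈ G) (h0 : Msg.block Block.genesis ∈ G) {p : Pair N}
    (hp : P.Justified V p) : Msg.block p.1 ∈ G := by
  rcases hp.eq_or_exists_att with rfl | ⟨α, hα, rfl⟩
  · exact h0
  · rw [hG.target_eq (hV _ hα)]
    exact hG.mem_of_mem_chain (hG.block_mem_of_att_mem (hV _ hα)) (LEBB_mem_chain _)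

theorem IsView.LJ_spec {G : Finset (Msg N)} (hG : P.IsView G) {B : Block N}
    (hB : Msg.block B ∈ G) : P.Justified (P.ffgview B) (P.LJ B) ∧
      ∀ q, P.Justified (P.ffgview B) q →
        toLex (q.2, P.hash q.1) ≤ toLex ((P.LJ B).2, P.hash (P.LJ B).1) :=
  P.lastPair_spec (finite_justified G fun _ hα => hG.ffgview_subset hB hα) ⟨_, .genesis⟩

/-- The attestations in the view of a justified block precede those that justify it. -/
theorem not_justified_viewOf_self {X : Block N} {n : ℕ} {G : Finset (Msg N)} (hG : P.IsView G)
    (hX : Msg.block X ∈ G) (h0 : X ≠ .genesis) : ¬ P.Justified (viewOf X) (X, n) := by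
  intro h
  rcases h.eq_or_exists_att with h | ⟨α, hα, h⟩
  · exact h0 (congrArg Prod.fst h)
  · have hα' := hG.viewOf_subset hX hα
    rw [hG.target_eq hα'] at h
    -- An attestation with target block `X` is to `X` or a descendant, so it is larger than `X` and
    -- cannot be one of its ancestors.
    have hm : X ∈ α.block.chain := by
      have h1 : P.LEBB α.block = X := congrArg Prod.fst h
      exact h1 ▸ LEBB_mem_chain _
    have h1 := sizeOf_le_of_mem_viewOf hα
    have h2 := Block.sizeOf_le_of_mem_chain hm
    have h3 := (Msg.Dep.attested α).sizeOf_lt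
    simp only [Msg.block.sizeOf_spec] at h1 h3
    omega

theorem finite_blocks (G : Finset (Msg N)) : {B : Block N | Msg.block B ∈ G}.Finite :=
  G.finite_toSet.preimage Msg.block_injective.injOn

theorem exists_leaf {G : Finset (Msg N)} {B : Block N} (hB : Msg.block B ∈ G) :
    ∃ l ∈ leaves G, B ∈ l.chain := by
  obtain ⟨l, ⟨hl, hBl⟩, hmax⟩ := Set.exists_max_image {B' | Msg.block B' ∈ G ∧ B ∈ B'.chain}
    (fun B' => sizeOf B') ((finite_blocks G).subset fun _ h => h.1) ⟨B, hB, B.mem_chain_self⟩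
  refine ⟨l, ⟨hl, fun B' hB' hp => ?_⟩, hBl⟩
  have h1 := hmax B' ⟨hB', (Block.mem_chain_of_parent hp).2 (.inr hBl)⟩
  exact absurd h1 (Block.sizeOf_lt_of_parent hp).not_ge

theorem mem_leaves_of_subset {U G : Finset (Msg N)} (h : U ⊆ G) {l : Block N}
    (hl : l ∈ leaves G) (hU : Msg.block l ∈ U) : l ∈ leaves U :=
  ⟨hU, fun B' hB' => hl.2 B' (h hB')⟩

/-! ### The fork-choice rule -/

theorem IsView.filteredBlocks_subset {G : Finset (Msg N)} (hG : P.IsView G) {B : Block N}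
    (hB : B ∈ P.filteredBlocks G) : Msg.block B ∈ G := by
  obtain ⟨l, hl, _, h⟩ := hB
  exact hG.mem_of_mem_chain hl.1 h

theorem IsView.startPair_spec {G : Finset (Msg N)} (hG : P.IsView G)
    (h0 : Msg.block Block.genesis ∈ G) :
    (∃ l ∈ leaves G, P.Justified (P.ffgview l) (P.startPair G)) ∧
    ∀ l ∈ leaves G, ∀ q, P.Justified (P.ffgview l) q →
      toLex (q.2, P.hash q.1) ≤ toLex ((P.startPair G).2, P.hash (P.startPair G).1) := by
  have hfin : {p | ∃ l ∈ leaves G, P.Justified (P.ffgview l) p}.Finite := by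
    refine (finite_justified (P := P) (V := (G : Set (Msg N))) G fun _ h => h).subset ?_
    rintro p ⟨l, hl, hp⟩
    exact hp.mono fun α hα => hG.ffgview_subset hl.1 hα
  obtain ⟨l, hl, _⟩ := exists_leaf h0
  have h := P.lastPair_spec hfin ⟨(Block.genesis, 0), l, hl, .genesis⟩
  exact ⟨h.1, fun l hl q hq => h.2 q ⟨l, hl, hq⟩⟩

theorem IsView.startPair_mem {G : Finset (Msg N)} (hG : P.IsView G)
    (h0 : Msg.block Block.genesis ∈ G) : Msg.block (P.startPair G).1 ∈ G := by
  obtain ⟨l, hl, h⟩ := (hG.startPair_spec h0).1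
  exact hG.justified_block_mem (fun m hm => hG.ffgview_subset hl.1 hm) h0 h

/-- The two maxima are taken over the same set: no leaf justifies more than `Z`, and one leaf has
the FFG view of `Z`. -/
theorem startPair_eq_LJ {G : Finset (Msg N)} {Z : Block N}
    (h : ∀ l ∈ leaves G, ∀ p, P.Justified (P.ffgview l) p → P.Justified (P.ffgview Z) p)
    (hZ : ∃ l ∈ leaves G, P.ffgview l = P.ffgview Z) : P.startPair G = P.LJ Z := by
  unfold startPair LJ
  congr 1
  ext p
  constructor
  · rintro ⟨l, hl, hp⟩
    exact h l hl p hp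
  · intro hp
    obtain ⟨l, hl, hlZ⟩ := hZ
    exact ⟨l, hl, hlZ ▸ hp⟩

variable (P) in
/-- `B` is the heaviest of its siblings in the filtered tree. -/
def Dominant (G : Finset (Msg N)) (B : Block N) : Prop :=
  B ∈ P.filteredBlocks G ∧ ∀ q, B.parent = some q → ∀ B' ∈ P.filteredBlocks G,
    B'.parent = some q → toLex (P.weight G B', P.hash B') ≤ toLex (P.weight G B, P.hash B)

theorem forkStep_eq_of_dominant {G : Finset (Msg N)} {B q : Block N} (h : P.Dominant G B)
    (hq : B.parent = some q) : P.forkStep G q = B :=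
  argmax_eq (P.childKey_injective G) ⟨h.1, hq⟩ fun B' hB' => h.2 q hq B' hB'.1 hB'.2

theorem forkStep_eq_self {G : Finset (Msg N)} {B : Block N}
    (h : ∀ B' ∈ P.filteredBlocks G, B'.parent ≠ some B) : P.forkStep G B = B :=
  argmax_of_not fun ⟨B', hB', _⟩ => h B' hB'.1 hB'.2

theorem IsView.forkStep_child {G : Finset (Msg N)} (hG : P.IsView G) {B : Block N}
    (h : ∃ B' ∈ P.filteredBlocks G, B'.parent = some B) :
    P.Dominant G (P.forkStep G B) ∧ (P.forkStep G B).parent = some B := by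
  have hs := argmax_spec (d := B) (Set.exists_max_image
    {B' | B' ∈ P.filteredBlocks G ∧ B'.parent = some B}
    (fun B' => toLex (P.weight G B', P.hash B'))
    ((finite_blocks G).subset fun _ h => hG.filteredBlocks_subset h.1) h)
  refine ⟨⟨hs.1.1, fun q hq B' hB' hp => hs.2 B' ⟨hB', ?_⟩⟩, hs.1.2⟩
  have h2 := hs.1.2
  rw [show q = B from Option.some_injective _ (hq.symm.trans h2)] at hp
  exact hp

theorem IsView.forkStep_cases {G : Finset (Msg N)} (hG : P.IsView G) (B : Block N) :
    P.forkStep G B = B ∨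
      P.Dominant G (P.forkStep G B) ∧ (P.forkStep G B).parent = some B := by
  by_cases h : ∃ B' ∈ P.filteredBlocks G, B'.parent = some B
  · exact .inr (hG.forkStep_child h)
  · exact .inl (forkStep_eq_self fun B' hB' hp => h ⟨B', hB', hp⟩)

theorem IsView.mem_chain_iterate {G : Finset (Msg N)} (hG : P.IsView G) (B : Block N) (n : ℕ) :
    B ∈ ((P.forkStep G)^[n] B).chain := by
  induction n with
  | zero => exact B.mem_chain_self
  | succ n ih =>
    rw [Function.iterate_succ_apply']
    rcases hG.forkStep_cases ((P.forkStep G)^[n] B) with h | h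
    · rwa [h]
    · exact (Block.mem_chain_of_parent h.2).2 (.inr ih)

theorem IsView.iterate_mem {G : Finset (Msg N)} (hG : P.IsView G) {B : Block N}
    (hB : Msg.block B ∈ G) (n : ℕ) : Msg.block ((P.forkStep G)^[n] B) ∈ G := by
  induction n with
  | zero => exact hB
  | succ n ih =>
    rw [Function.iterate_succ_apply']
    rcases hG.forkStep_cases ((P.forkStep G)^[n] B) with h | h
    · rwa [h]
    · exact hG.filteredBlocks_subset h.1.1

theorem IsView.hlmd_mem {G : Finset (Msg N)} (hG : P.IsView G)
    (h0 : Msg.block Block.genesis ∈ G) : Msg.block (P.hlmd G) ∈ G :=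
  hG.iterate_mem (hG.startPair_mem h0) _

theorem IsView.startPair_mem_chain_hlmd {G : Finset (Msg N)} (hG : P.IsView G) :
    (P.startPair G).1 ∈ (P.hlmd G).chain :=
  hG.mem_chain_iterate _ _

/-- The walk descends one generation at a time, so every block strictly above its start and below
its end was chosen at some step. -/
theorem IsView.dominant_of_mem_chain_iterate {G : Finset (Msg N)} (hG : P.IsView G)
    (B : Block N) (n : ℕ) {A : Block N} (hA : A ∈ ((P.forkStep G)^[n] B).chain)
    (hB : B ∈ A.chain) (hne : A ≠ B) : P.Dominant G A := by
  induction n with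
  | zero => exact absurd (Block.chain_antisymm hA hB) hne
  | succ n ih =>
    rw [Function.iterate_succ_apply'] at hA
    rcases hG.forkStep_cases ((P.forkStep G)^[n] B) with h | h
    · rw [h] at hA
      exact ih hA
    · rcases (Block.mem_chain_of_parent h.2).1 hA with hA | hA
      · rw [hA]
        exact h.1
      · exact ih hA

theorem IsView.length_chain_le {G : Finset (Msg N)} (hG : P.IsView G) {B : Block N}
    (hB : Msg.block B ∈ G) : B.chain.length ≤ G.card := by
  classical
  have hnd := B.chain_nodup.map Msg.block_injective
  rw [← List.length_map (Msg.block), ← List.toFinset_card_of_nodup hnd]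
  refine Finset.card_le_card fun m hm => ?_
  obtain ⟨A, hA, rfl⟩ := List.mem_map.1 (List.mem_toFinset.1 hm)
  exact hG.mem_of_mem_chain hB hA

/-- The loop of the fork-choice rule has ended at the head. -/
theorem IsView.hlmd_no_child {G : Finset (Msg N)} (hG : P.IsView G)
    (h0 : Msg.block Block.genesis ∈ G) {B : Block N} (hB : B ∈ P.filteredBlocks G) :
    B.parent ≠ some (P.hlmd G) := by
  intro hp
  have key : ∀ n ≤ G.card, n + 1 ≤ ((P.forkStep G)^[n] (P.startPair G).1).chain.length := by
    intro n
    induction n with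
    | zero =>
      intro _
      exact List.length_pos_of_mem (Block.mem_chain_self _)
    | succ n ih =>
      intro hn
      have hc : ∃ B' ∈ P.filteredBlocks G,
          B'.parent = some ((P.forkStep G)^[n] (P.startPair G).1) := by
        by_contra hc
        -- A walk that is stuck after `n` steps has reached the head already, and `B` would be a
        -- child there.
        have hfix : P.forkStep G ((P.forkStep G)^[n] (P.startPair G).1) =
            (P.forkStep G)^[n] (P.startPair G).1 :=
          forkStep_eq_self fun B' hB' hp' => hc ⟨B', hB', hp'⟩
        refine hc ⟨B, hB, ?_⟩
        rw [hp, hlmd, ← Nat.sub_add_cancel (Nat.le_of_succ_le hn), Function.iterate_add_apply,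
          Function.iterate_fixed hfix]
      rw [Function.iterate_succ_apply', Block.chain_of_parent (hG.forkStep_child hc).2,
        List.length_cons]
      have := ih (by omega)
      omega
  have h1 := key _ le_rfl
  have h2 := hG.length_chain_le (hG.iterate_mem (hG.startPair_mem h0) G.card)
  omega

/-- The walk retraces the path from `S` to `Z`, since each block on it is the choice at its parent.
The bound on `n` is compared with the `G.card` iterations of the loop. -/
theorem exists_iterate_eq {G : Finset (Msg N)} {S Z : Block N} (hS : S ∈ Z.chain)
    (h : ∀ A ∈ Z.chain, S ∈ A.chain → A ≠ S → P.Dominant G A) :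
    ∃ n, (P.forkStep G)^[n] S = Z ∧ n ≤ Z.chain.length := by
  induction Z using Block.parent_induction with
  | genesis =>
    obtain rfl : S = .genesis := by simpa [Block.chain] using hS
    exact ⟨0, rfl, Nat.zero_le _⟩
  | mk v i p l d ih =>
    by_cases hne : Block.mk v i p l d = S
    · exact ⟨0, hne.symm, Nat.zero_le _⟩
    · have hSp := ((Block.mem_chain_of_parent rfl).1 hS).resolve_left (Ne.symm hne)
      obtain ⟨n, hn, hle⟩ := ih hSp fun A hA => h A ((Block.mem_chain_of_parent rfl).2 (.inr hA))
      refine ⟨n + 1, ?_, by simpa [Block.chain] using hle⟩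
      rw [Function.iterate_succ_apply', hn]
      exact forkStep_eq_of_dominant (h _ (Block.mem_chain_self _) hS hne) rfl

theorem IsView.mem_chain_hlmd_of_dominant {G : Finset (Msg N)} (hG : P.IsView G) {Z : Block N}
    (hZ : Msg.block Z ∈ G) (hS : (P.startPair G).1 ∈ Z.chain)
    (h : ∀ A ∈ Z.chain, (P.startPair G).1 ∈ A.chain → A ≠ (P.startPair G).1 → P.Dominant G A) :
    Z ∈ (P.hlmd G).chain := by
  obtain ⟨n, hn, hle⟩ := exists_iterate_eq hS h
  rw [hlmd, ← Nat.sub_add_cancel (hle.trans (hG.length_chain_le hZ)),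
    Function.iterate_add_apply, hn]
  exact hG.mem_chain_iterate _ _

/-! ### The effect of new attestations on the weights -/

theorem exists_isLatest {G : Finset (Msg N)} {α : Attestation N} (hα : Msg.att α ∈ G) :
    ∃ β, P.IsLatest G β ∧ β.author = α.author := by
  have hinj : Function.Injective (Msg.att (N := N)) := fun _ _ h => by simpa using h
  obtain ⟨β, ⟨hβ, hβa⟩, hmax⟩ := Set.exists_max_image
    {β | Msg.att β ∈ G ∧ β.author = α.author} (fun β => toLex (β.slot, P.hash β.block))
    ((G.finite_toSet.preimage hinj.injOn).subset fun _ h => h.1) ⟨α, hα, rfl⟩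
  exact ⟨β, ⟨hβ, fun γ hγ hγa => hmax γ ⟨hγ, hγa.trans hβa⟩⟩, hβa⟩

/-- New attestations have later slots, so an author of one has a new latest attestation, which
supports `A`; the other authors keep theirs. -/
theorem weight_le_of_mem_chain {U G : Finset (Msg N)} (hUG : U ⊆ G) {A : Block N}
    (hnew : ∀ α, Msg.att α ∈ G → Msg.att α ∉ U → A ∈ α.block.chain)
    (hslot : ∀ α, Msg.att α ∈ G → Msg.att α ∉ U → ∀ β, Msg.att β ∈ U → β.slot < α.slot) :
    P.weight U A ≤ P.weight G A := by
  refine Finset.sum_le_sum_of_subset_of_nonneg ?_ fun v _ _ => (P.stake_pos v).le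
  intro v
  simp only [Finset.mem_filter, Finset.mem_univ, true_and]
  rintro ⟨α, hα, rfl, hA⟩
  by_cases h : ∃ β, Msg.att β ∈ G ∧ Msg.att β ∉ U ∧ β.author = α.author
  · obtain ⟨β, hβ, hβU, hβa⟩ := h
    obtain ⟨γ, hγ, hγa⟩ := exists_isLatest (P := P) hβ
    refine ⟨γ, hγ, hγa.trans hβa, hnew γ hγ.1 fun hγU => ?_⟩
    have h1 := hγ.2 β hβ hγa.symm
    have h2 := hslot β hβ hβU γ hγU
    rcases Prod.Lex.toLex_le_toLex.1 h1 with h1 | ⟨h1, _⟩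
    · exact absurd h1 h2.not_gt
    · exact absurd h1 h2.ne'
  · refine ⟨α, ⟨hUG hα.1, fun β hβ hβa => hα.2 β ?_ hβa⟩, rfl, hA⟩
    by_contra hβU
    exact h ⟨β, hβ, hβU, hβa⟩

theorem weight_le_of_not_mem_chain {U G : Finset (Msg N)} (hUG : U ⊆ G) {A : Block N}
    (hnew : ∀ α, Msg.att α ∈ G → Msg.att α ∉ U → A ∉ α.block.chain) :
    P.weight G A ≤ P.weight U A := by
  refine Finset.sum_le_sum_of_subset_of_nonneg ?_ fun v _ _ => (P.stake_pos v).le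
  intro v
  simp only [Finset.mem_filter, Finset.mem_univ, true_and]
  rintro ⟨α, hα, rfl, hA⟩
  have hU : Msg.att α ∈ U := by
    by_contra hU
    exact hnew α hα.1 hU hA
  exact ⟨α, ⟨hU, fun β hβ hβa => hα.2 β (hUG hβ) hβa⟩, rfl, hA⟩

theorem ep_eq_iff {i k : ℕ} : P.ep i = k ↔ k * P.C ≤ i ∧ i < (k + 1) * P.C := by
  rw [ep, Nat.div_eq_iff P.C_pos, Nat.add_mul, Nat.one_mul]
  have := P.C_pos
  constructor <;> rintro ⟨h1, h2⟩ <;> constructor <;> omega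

theorem ep_mul (k : ℕ) : P.ep (k * P.C) = k := Nat.mul_div_cancel k P.C_pos

/-! ### Proposals at epoch boundaries -/

variable (P) in
/-- `Z` is what the protocol lets the proposer of the first slot of epoch `k` propose with the
view `U`, which contains messages from earlier epochs only. -/
structure ProposedOn (U : Finset (Msg N)) (k : ℕ) (Z : Block N) : Prop where
  isView : P.IsView U
  genesis_mem : Msg.block Block.genesis ∈ U
  slot_lt : ∀ m ∈ U, m.slot < k * P.C
  proposal : P.IsProposal (P.proposer (k * P.C)) (k * P.C) U Z

namespace ProposedOn

variable {U : Finset (Msg N)} {k : ℕ} {Z : Block N} (h : P.ProposedOn U k Z)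
include h

theorem slot_eq : Z.slot = k * P.C := h.proposal.2.1

theorem parent_eq : Z.parent = some (P.hlmd U) := h.proposal.2.2.1

theorem not_mem : Msg.block Z ∉ U := fun hZ =>
  absurd (h.slot_lt _ hZ) (by simp [Msg.slot, h.slot_eq])

theorem hlmd_mem : Msg.block (P.hlmd U) ∈ U := h.isView.hlmd_mem h.genesis_mem

theorem mem_viewOf {m : Msg N} (hm : m ∈ viewOf Z) : m = Msg.block Z ∨ m ∈ U := by
  induction (show Relation.ReflTransGen Msg.Dep m (Msg.block Z) from hm)
    using Relation.ReflTransGen.head_induction_on with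
  | refl => exact .inl rfl
  | head hd hr ih =>
    refine .inr ?_
    rcases ih hr with rfl | hU
    · cases hd with
      | parent hp =>
        rw [Option.some_injective _ (hp.symm.trans h.parent_eq)]
        exact h.hlmd_mem
      | newattest hα => exact ((h.proposal.2.2.2 _).1 hα).1
    · exact h.isView.2 _ hU _ hd

/-- An attestation in `U` is either included by an ancestor already or newly included by `Z`. This
is where the rule that a proposal includes all pending attestations enters. -/
theorem att_mem_viewOf_iff {α : Attestation N} : Msg.att α ∈ viewOf Z ↔ Msg.att α ∈ U := by
  refine ⟨fun hα => (h.mem_viewOf hα).resolve_left (by simp), fun hα => ?_⟩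
  by_cases hc : ∀ A ∈ (P.hlmd U).chain, α ∉ A.newattests
  · exact att_mem_viewOf Z.mem_chain_self ((h.proposal.2.2.2 α).2 ⟨hα, hc⟩)
  · push Not at hc
    obtain ⟨A, hA, hαA⟩ := hc
    exact att_mem_viewOf ((Block.mem_chain_of_parent h.parent_eq).2 (.inr hA)) hαA

theorem EBB_eq {j : ℕ} (hj : k ≤ j) : P.EBB Z j = Z :=
  Block.lastUpTo_of_le (h.slot_eq.le.trans (Nat.mul_le_mul_right _ hj))

theorem ep_slot_eq : P.ep Z.slot = k := by rw [h.slot_eq, ep_mul]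

theorem LEBB_eq : P.LEBB Z = Z := h.EBB_eq h.ep_slot_eq.ge

theorem ffgview_eq : P.ffgview Z = viewOf Z := by rw [ffgview, h.LEBB_eq]

theorem justified_iff {p : Pair N} : P.Justified (P.ffgview Z) p ↔ P.Justified (U : Set _) p := by
  rw [h.ffgview_eq]
  exact ⟨.mono fun _ => h.att_mem_viewOf_iff.1, .mono fun _ => h.att_mem_viewOf_iff.2⟩

theorem LJ_spec : P.Justified (U : Set _) (P.LJ Z) ∧ ∀ q, P.Justified (U : Set _) q →
    toLex (q.2, P.hash q.1) ≤ toLex ((P.LJ Z).2, P.hash (P.LJ Z).1) := by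
  have hs := P.lastPair_spec (S := {p | P.Justified (P.ffgview Z) p})
    (finite_justified U fun α hα => by
      rw [h.ffgview_eq] at hα
      exact h.att_mem_viewOf_iff.1 hα) ⟨_, .genesis⟩
  exact ⟨h.justified_iff.1 hs.1, fun q hq => hs.2 q (h.justified_iff.2 hq)⟩

/-- If a leaf of the old view already sees the last justified pair of the new block, then the fork
choice in the old view starts from this pair. -/
theorem startPair_eq {l : Block N} (hl : l ∈ leaves U)
    (hp : P.Justified (P.ffgview l) (P.LJ Z)) : P.startPair U = P.LJ Z := by
  refine P.lastPair_eq ⟨l, hl, hp⟩ ?_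
  rintro q ⟨l', hl', hq⟩
  exact h.LJ_spec.2 q (hq.mono fun _ hα => h.isView.ffgview_subset hl'.1 hα)

end ProposedOn

-- The head of the chain during one epoch

variable (P) in
/-- The view `G` arises from the view `U` and the proposal `Z` at the first slot of epoch `k` by
adding later blocks of the epoch, each with a parent in `D`, and attestations of the epoch, all of
them to blocks in `D`. -/
structure Extends (U : Finset (Msg N)) (k : ℕ) (Z : Block N) (D : Block N → Prop)
    (G : Finset (Msg N)) : Prop where
  isView : P.IsView G
  subset : U ⊆ G
  mem : Msg.block Z ∈ G
  blocks : ∀ B, Msg.block B ∈ G → Msg.block B ∉ U →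
    B = Z ∨ ∃ B', D B' ∧ B.parent = some B' ∧ k * P.C < B.slot ∧ P.ep B.slot = k
  atts : ∀ α, Msg.att α ∈ G → Msg.att α ∉ U → P.ep α.slot = k ∧ D α.block

variable (P) in
/-- `B` is a descendant of the epoch boundary block `Z` from the epoch `k`. -/
def OnBranch (Z : Block N) (k : ℕ) (B : Block N) : Prop :=
  Z ∈ B.chain ∧ P.ep B.slot = k ∧ P.EBB B k = Z

theorem OnBranch.LEBB_eq {Z B : Block N} {k : ℕ} (h : P.OnBranch Z k B) : P.LEBB B = Z := by
  rw [LEBB, h.2.1, h.2.2]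

theorem ProposedOn.onBranch {U : Finset (Msg N)} {k : ℕ} {Z : Block N}
    (h : P.ProposedOn U k Z) : P.OnBranch Z k Z :=
  ⟨Z.mem_chain_self, h.ep_slot_eq, h.EBB_eq le_rfl⟩

theorem OnBranch.ffgview_eq {U : Finset (Msg N)} {k : ℕ} {Z B : Block N}
    (h : P.ProposedOn U k Z) (hB : P.OnBranch Z k B) : P.ffgview B = P.ffgview Z := by
  rw [ffgview, ffgview, hB.LEBB_eq, h.LEBB_eq]

theorem OnBranch.LJ_eq {U : Finset (Msg N)} {k : ℕ} {Z B : Block N}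
    (h : P.ProposedOn U k Z) (hB : P.OnBranch Z k B) : P.LJ B = P.LJ Z := by
  rw [LJ, LJ, hB.ffgview_eq h]

section Epoch

variable {U G : Finset (Msg N)} {k : ℕ} {Z : Block N}

theorem Extends.mem_or_onBranch (h : P.ProposedOn U k Z)
    (hG : P.Extends U k Z (P.OnBranch Z k) G) {B : Block N} (hB : Msg.block B ∈ G) :
    Msg.block B ∈ U ∨ P.OnBranch Z k B := by
  by_cases hU : Msg.block B ∈ U
  · exact .inl hU
  · refine .inr ?_
    rcases hG.blocks B hB hU with rfl | ⟨B', hB', hp, hs, he⟩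
    · exact h.onBranch
    · exact ⟨(Block.mem_chain_of_parent hp).2 (.inr hB'.1), he,
        (Block.lastUpTo_of_parent hp hs).trans hB'.2.2⟩

theorem ProposedOn.not_mem_chain (h : P.ProposedOn U k Z) {B : Block N}
    (hB : Msg.block B ∈ U) : Z ∉ B.chain :=
  fun hZ => h.not_mem (h.isView.mem_of_mem_chain hB hZ)

/-- Old leaves see only a part of `U`, all of which counts in `Z`; new leaves have the FFG view of
`Z`; and some leaf lies above `Z`. -/
theorem Extends.startPair_eq (h : P.ProposedOn U k Z)
    (hG : P.Extends U k Z (P.OnBranch Z k) G) : P.startPair G = P.LJ Z := by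
  refine startPair_eq_LJ (fun l hl p hp => ?_) ?_
  · rcases hG.mem_or_onBranch h hl.1 with hU | hb
    · exact h.justified_iff.2 (hp.mono fun _ hα => h.isView.ffgview_subset hU hα)
    · rwa [← hb.ffgview_eq h]
  · obtain ⟨l, hl, hZ⟩ := exists_leaf hG.mem
    have hb := (hG.mem_or_onBranch h hl.1).resolve_left fun hU => h.not_mem_chain hU hZ
    exact ⟨l, hl, hb.ffgview_eq h⟩

/-- If the chain of the proposal contains its last justified block, then the head of the chain
stays above the proposal. -/
theorem Extends.onBranch_hlmd (h : P.ProposedOn U k Z)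
    (hG : P.Extends U k Z (P.OnBranch Z k) G) (hJ : (P.LJ Z).1 ∈ Z.chain) :
    P.OnBranch Z k (P.hlmd G) := by
  have hst := hG.startPair_eq h
  have hZ : Z ∈ (P.hlmd G).chain := by
    refine hG.isView.mem_chain_hlmd_of_dominant hG.mem (hst ▸ hJ) fun A hA hJA hne => ?_
    rw [hst] at hJA hne
    constructor
    · obtain ⟨l, hl, hZl⟩ := exists_leaf hG.mem
      have hb := (hG.mem_or_onBranch h hl.1).resolve_left fun hU => h.not_mem_chain hU hZl
      refine ⟨l, hl, ?_, Block.chain_trans hA hZl⟩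
      rw [hst, hb.ffgview_eq h, h.justified_iff]
      exact h.LJ_spec.1
    · intro q hq A' hA' hq'
      by_cases hAA : A' = A
      · rw [hAA]
      have hnot : ∀ B : Block N, Z ∈ B.chain → A' ∉ B.chain := fun B hZB hA'B =>
        hAA (Block.eq_of_mem_chain_of_parent_eq hA'B (Block.chain_trans hA hZB) hq' hq)
      -- A rival `A'` passes the filter only through an old leaf that sees `LJ Z` as justified.
      -- Hence the fork choice in `U` started from the same pair, and `A'` was a candidate there
      -- too.
      obtain ⟨l, hl, hpl, hA'l⟩ := hA'
      rw [hst] at hpl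
      have hlU := (hG.mem_or_onBranch h hl.1).resolve_right fun hb => hnot l hb.1 hA'l
      have hlU' := mem_leaves_of_subset hG.subset hl hlU
      have hstU := h.startPair_eq hlU' hpl
      have hA'U : A' ∈ P.filteredBlocks U := ⟨l, hlU', hstU.symm ▸ hpl, hA'l⟩
      -- Otherwise the rival would be a child of the head of `U`, where the loop has ended.
      have hAZ : A ≠ Z := by
        rintro rfl
        refine h.isView.hlmd_no_child h.genesis_mem hA'U ?_
        rw [hq', ← hq, h.parent_eq]
      have hAU : A ∈ (P.hlmd U).chain :=
        ((Block.mem_chain_of_parent h.parent_eq).1 hA).resolve_left hAZ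
      have hdom : P.Dominant U A :=
        h.isView.dominant_of_mem_chain_iterate _ _ hAU (hstU.symm ▸ hJA) (hstU.symm ▸ hne)
      -- `A` had won against `A'` in `U`, and the new attestations are all above `Z`: they can only
      -- help `A` and never `A'`.
      have h1 := hdom.2 q hq A' hA'U hq'
      have h2 : P.weight G A' ≤ P.weight U A' :=
        weight_le_of_not_mem_chain hG.subset fun α hα hαU => hnot _ (hG.atts α hα hαU).2.1
      have h3 : P.weight U A ≤ P.weight G A := by
        refine weight_le_of_mem_chain hG.subset
          (fun α hα hαU => Block.chain_trans hA (hG.atts α hα hαU).2.1)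
          fun α hα hαU β hβ => (h.slot_lt _ hβ).trans_le ?_
        exact (ep_eq_iff.1 (hG.atts α hα hαU).1).1
      rw [Prod.Lex.toLex_le_toLex] at h1 ⊢
      rcases h1 with h1 | ⟨h1, h1'⟩
      · exact .inl (h2.trans_lt (h1.trans_le h3))
      · rcases (h2.trans (h1.le.trans h3)).lt_or_eq with h4 | h4
        · exact .inl h4
        · exact .inr ⟨h4, h1'⟩
  refine (hG.mem_or_onBranch h ?_).resolve_left fun hU => h.not_mem_chain hU hZ
  exact hG.isView.hlmd_mem (hG.subset h.genesis_mem)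

/-- If the chain of the proposal does not contain its last justified block, then this block is the
head of the chain until the end of the epoch. -/
theorem Extends.hlmd_eq_of_not_mem (h : P.ProposedOn U k Z)
    (hG : P.Extends U k Z (· = (P.LJ Z).1) G) (hJ : (P.LJ Z).1 ∉ Z.chain) :
    P.hlmd G = (P.LJ Z).1 := by
  set X := (P.LJ Z).1 with hX
  have hXU : Msg.block X ∈ U :=
    h.isView.justified_block_mem (fun _ hm => hm) h.genesis_mem h.LJ_spec.1
  have hX0 : X ≠ .genesis := fun h0 => hJ (h0 ▸ Z.genesis_mem_chain)
  have hcases : ∀ l, Msg.block l ∈ G →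
      Msg.block l ∈ U ∨ l = Z ∨ l.parent = some X ∧ P.ffgview l = viewOf X := by
    intro l hl
    by_cases hU : Msg.block l ∈ U
    · exact .inl hU
    · rcases hG.blocks l hl hU with hlZ | ⟨B', rfl, hp, hs, he⟩
      · exact .inr (.inl hlZ)
      · refine .inr (.inr ⟨hp, ?_⟩)
        -- The child `l` is newer than the epoch boundary and its parent `X` is older, so `X` is the
        -- last epoch boundary block of `l`.
        rw [ffgview, LEBB, EBB, he, Block.lastUpTo_of_parent hp hs, Block.lastUpTo_of_le]
        exact (h.slot_lt _ hXU).le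
  have hst : P.startPair G = P.LJ Z := by
    refine startPair_eq_LJ (fun l hl p hp => ?_) ⟨Z, ⟨hG.mem, fun B' hB' hp => ?_⟩, rfl⟩
    · rcases hcases l hl.1 with hU | rfl | ⟨_, hv⟩
      · exact h.justified_iff.2 (hp.mono fun _ hα => h.isView.ffgview_subset hU hα)
      · exact hp
      · rw [hv] at hp
        exact h.justified_iff.2 (hp.mono fun _ hα => h.isView.viewOf_subset hXU hα)
    · rcases hcases B' hB' with hU | rfl | ⟨hp', _⟩
      · exact h.not_mem_chain hU ((Block.mem_chain_of_parent hp).2 (.inr Z.mem_chain_self))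
      · exact absurd (Block.sizeOf_lt_of_parent hp) (lt_irrefl _)
      · rw [Option.some_injective _ (hp.symm.trans hp')] at h
        exact h.not_mem hXU
  have hfix : P.forkStep G X = X := by
    refine forkStep_eq_self ?_
    rintro B ⟨l, hl, hp, hBl⟩ hBX
    have hXl : X ∈ l.chain :=
      Block.chain_trans ((Block.mem_chain_of_parent hBX).2 (.inr X.mem_chain_self)) hBl
    rw [hst] at hp
    -- No leaf above `X` passes the filter: an old one would have put `X` into the chain of the head
    -- of `U`, hence of `Z`; `Z` is not above `X`; and a new child of `X` sees only the view of `X`,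
    -- which cannot justify `X`.
    rcases hcases l hl.1 with hU | rfl | ⟨_, hv⟩
    · have hstU := h.startPair_eq (mem_leaves_of_subset hG.subset hl hU) hp
      have hm := h.isView.startPair_mem_chain_hlmd (P := P)
      rw [hstU] at hm
      exact hJ ((Block.mem_chain_of_parent h.parent_eq).2 (.inr hm))
    · exact hJ hXl
    · rw [hv] at hp
      exact not_justified_viewOf_self h.isView hXU hX0 hp
  rw [hlmd, hst]
  exact Function.iterate_fixed hfix _

end Epoch

/-! ### The votes of an epoch -/

variable (P) in
/-- In the view `G`, all attestations from the epoch `k` or later have the target `(T, k)`, and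
there is a supermajority link from the justified pair `q` to `(T, k)`. -/
structure EpochVotes (G : Finset (Msg N)) (k : ℕ) (q : Pair N) (T : Block N) : Prop where
  justified : P.Justified (G : Set (Msg N)) q
  link : P.SupermajorityLink (G : Set (Msg N)) q (T, k)
  target_eq : ∀ α, Msg.att α ∈ G → k ≤ P.ep α.slot → α.target = (T, k)

theorem EpochVotes.justified_target {G : Finset (Msg N)} {k : ℕ} {q : Pair N} {T : Block N}
    (hv : P.EpochVotes G k q T) : P.Justified (G : Set (Msg N)) (T, k) :=
  .link hv.justified hv.link

/-- A target carries the epoch of its attestation. So a justified pair of epoch at least `k` is `(T,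
k)` itself or the genesis pair, and `1 ≤ k` excludes the latter. -/
theorem EpochVotes.LJ_eq {G : Finset (Msg N)} {k : ℕ} {q : Pair N} {T Z : Block N}
    (hv : P.EpochVotes G k q T) (hk : 1 ≤ k) (h : P.ProposedOn G (k + 1) Z) :
    P.LJ Z = (T, k) := by
  refine P.lastPair_eq (h.justified_iff.2 hv.justified_target) fun p hp => ?_
  rcases (h.justified_iff.1 hp).eq_or_exists_att with rfl | ⟨α, hα, rfl⟩
  · exact Prod.Lex.toLex_le_toLex.2 (.inl hk)
  · by_cases hs : k ≤ P.ep α.slot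
    · rw [hv.target_eq α hα hs]
    · rw [h.isView.target_eq hα]
      exact Prod.Lex.toLex_le_toLex.2 (.inl (not_le.1 hs))

/-! ### Synchronous runs of the protocol -/

variable (P) in
/-- A view that can be held at time `t`. -/
structure Timely (G : Finset (Msg N)) (t : ℕ) : Prop where
  isView : P.IsView G
  genesis_mem : Msg.block Block.genesis ∈ G
  slot_le : ∀ m ∈ G, m.slot ≤ (t - 1) / 2

theorem Timely.mono {G : Finset (Msg N)} {t t' : ℕ} (h : P.Timely G t) (ht : t ≤ t') :
    P.Timely G t' :=
  ⟨h.isView, h.genesis_mem, fun m hm => (h.slot_le m hm).trans (by omega)⟩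

variable (P) in
theorem exists_newattests (G : Finset (Msg N)) : ∃ l : List (Attestation N),
    ∀ α, α ∈ l ↔ Msg.att α ∈ G ∧ ∀ A ∈ (P.hlmd G).chain, α ∉ A.newattests := by
  have hinj : Function.Injective (Msg.att (N := N)) := fun _ _ h => by simpa using h
  have hfin : {α | Msg.att α ∈ G ∧ ∀ A ∈ (P.hlmd G).chain, α ∉ A.newattests}.Finite :=
    (G.finite_toSet.preimage hinj.injOn).subset fun _ h => h.1
  exact ⟨hfin.toFinset.toList, fun α => by simp⟩

variable (P) in
/-- The block with data `d` that is proposed in slot `i` with the view `G`. -/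
noncomputable def proposal (d i : ℕ) (G : Finset (Msg N)) : Block N :=
  .mk (P.proposer i) i (P.hlmd G) (P.exists_newattests G).choose d

theorem isProposal_proposal (d i : ℕ) (G : Finset (Msg N)) :
    P.IsProposal (P.proposer i) i G (P.proposal d i G) :=
  ⟨rfl, rfl, rfl, (P.exists_newattests G).choose_spec⟩

open Classical in
variable (P) in
/-- What the validators in `A` broadcast at time `t` if all of them have the view `G`. -/
noncomputable def sent (A : Finset (Fin N)) (d t : ℕ) (G : Finset (Msg N)) : Finset (Msg N) :=
  if t % 2 = 0 then
    if 1 ≤ t / 2 ∧ P.proposer (t / 2) ∈ A then {Msg.block (P.proposal d (t / 2) G)} else ∅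
  else
    (A.filter (· ∈ P.committee (t / 2))).image
      fun v => Msg.att (P.attestation v (t / 2) (P.hlmd G))

theorem mem_sent_even {A : Finset (Fin N)} {d i : ℕ} {G : Finset (Msg N)} {m : Msg N} :
    m ∈ P.sent A d (2 * i) G ↔
      (1 ≤ i ∧ P.proposer i ∈ A) ∧ m = Msg.block (P.proposal d i G) := by
  have h2 : 2 * i / 2 = i := by omega
  rw [sent, if_pos (by omega), h2]
  split_ifs with h <;> simp [h]

theorem mem_sent_odd {A : Finset (Fin N)} {d i : ℕ} {G : Finset (Msg N)} {m : Msg N} :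
    m ∈ P.sent A d (2 * i + 1) G ↔
      ∃ v ∈ A, v ∈ P.committee i ∧ m = Msg.att (P.attestation v i (P.hlmd G)) := by
  have h2 : (2 * i + 1) / 2 = i := by omega
  rw [sent, if_neg (by omega), h2]
  simp only [Finset.mem_image, Finset.mem_filter, and_assoc, eq_comm]

theorem author_of_mem_sent {A : Finset (Fin N)} {d t : ℕ} {G : Finset (Msg N)} {m : Msg N}
    (h : m ∈ P.sent A d t G) {v : Fin N} (hv : m.author = some v) : v ∈ A := by
  obtain ⟨i, rfl | rfl⟩ := Nat.even_or_odd' t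
  · obtain ⟨⟨_, hA⟩, rfl⟩ := mem_sent_even.1 h
    rwa [← Option.some_injective _ (hv : some (P.proposer i) = some v)]
  · obtain ⟨w, hw, _, rfl⟩ := mem_sent_odd.1 h
    rwa [← Option.some_injective _ (hv : some w = some v)]

theorem prescribed_sent {A : Finset (Fin N)} {d t : ℕ} {G own : Finset (Msg N)} {v : Fin N}
    (hv : v ∈ A) (hown : ∀ m, m ∈ own ↔ m ∈ P.sent A d t G ∧ m.author = some v) :
    P.Prescribed v t G own := by
  constructor
  · rintro i rfl
    constructor
    · rintro ⟨hi, rfl⟩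
      refine ⟨_, isProposal_proposal d i G, Finset.ext fun m => ?_⟩
      rw [hown, mem_sent_even, Finset.mem_singleton]
      refine ⟨fun h => h.1.2, ?_⟩
      rintro rfl
      exact ⟨⟨⟨hi, hv⟩, rfl⟩, rfl⟩
    · intro hn
      refine Finset.eq_empty_of_forall_notMem fun m hm => ?_
      obtain ⟨h, ha⟩ := (hown m).1 hm
      obtain ⟨⟨hi, _⟩, rfl⟩ := mem_sent_even.1 h
      exact hn ⟨hi, (Option.some_injective _ (ha : some (P.proposer i) = some v)).symm⟩
  · rintro i rfl
    constructor
    · intro hc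
      refine Finset.ext fun m => ?_
      rw [hown, mem_sent_odd, Finset.mem_singleton]
      constructor
      · rintro ⟨⟨w, _, _, rfl⟩, ha⟩
        rw [show w = v from Option.some_injective _ ha]
      · rintro rfl
        exact ⟨⟨v, hv, hc, rfl⟩, rfl⟩
    · intro hc
      refine Finset.eq_empty_of_forall_notMem fun m hm => ?_
      obtain ⟨h, ha⟩ := (hown m).1 hm
      obtain ⟨w, _, hw, rfl⟩ := mem_sent_odd.1 h
      rw [show w = v from Option.some_injective _ ha] at hw
      exact hc hw

/-- Everything sent depends on `G` alone, so any selection of it may be added. This covers the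
common view as well as the view of one validator who has added just his own message. -/
theorem Timely.step {A : Finset (Fin N)} {d t : ℕ} {G G' : Finset (Msg N)} (h : P.Timely G t)
    (hsub : G ⊆ G') (hnew : ∀ m ∈ G', m ∈ G ∨ m ∈ P.sent A d t G) : P.Timely G' (t + 1) := by
  have hh := h.isView.hlmd_mem h.genesis_mem
  have hs : (P.hlmd G).slot ≤ (t - 1) / 2 := h.slot_le _ hh
  refine ⟨⟨fun m hm => ?_, fun m hm m' hd => ?_⟩, hsub h.genesis_mem, fun m hm => ?_⟩ <;>
    rcases hnew m hm with hG | hS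
  · exact h.isView.1 m hG
  · obtain ⟨i, rfl | rfl⟩ := Nat.even_or_odd' t
    · obtain ⟨⟨hi, _⟩, rfl⟩ := mem_sent_even.1 hS
      intro p hp
      obtain rfl := Option.some_injective _ (hp : some (P.hlmd G) = some p)
      refine ⟨?_, rfl⟩
      -- Here `(2 * i - 1) / 2 = i - 1`, because `1 ≤ i`.
      change (P.hlmd G).slot < i
      omega
    · obtain ⟨v, _, _, rfl⟩ := mem_sent_odd.1 hS
      refine ⟨?_, rfl⟩
      change (P.hlmd G).slot ≤ i
      omega
  · exact hsub (h.isView.2 m hG m' hd)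
  · obtain ⟨i, rfl | rfl⟩ := Nat.even_or_odd' t
    · obtain ⟨_, rfl⟩ := mem_sent_even.1 hS
      cases hd with
      | parent hp =>
        obtain rfl := Option.some_injective _ (hp : some (P.hlmd G) = some _)
        exact hsub hh
      | newattest hα => exact hsub (((isProposal_proposal d i G).2.2.2 _).1 hα).1
    · obtain ⟨v, _, _, rfl⟩ := mem_sent_odd.1 hS
      cases hd
      exact hsub hh
  · exact (h.slot_le m hG).trans (by omega)
  · obtain ⟨i, rfl | rfl⟩ := Nat.even_or_odd' t
    · obtain ⟨_, rfl⟩ := mem_sent_even.1 hS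
      change i ≤ _
      omega
    · obtain ⟨v, _, _, rfl⟩ := mem_sent_odd.1 hS
      change i ≤ _
      omega

variable (P) in
/-- From time `t₀` on, the validators in `A` follow the protocol with a common view, which is `U t`
at time `t`. -/
structure IsRun (A : Finset (Fin N)) (d t₀ : ℕ) (U : ℕ → Finset (Msg N)) : Prop where
  timely_start : P.Timely (U t₀) t₀
  mem_succ : ∀ t, t₀ ≤ t → ∀ m, m ∈ U (t + 1) ↔ m ∈ U t ∨ m ∈ P.sent A d t (U t)

variable (P) in
theorem exists_isRun (A : Finset (Fin N)) (d : ℕ) {t₀ : ℕ} {G : Finset (Msg N)}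
    (hG : P.Timely G t₀) : ∃ U, P.IsRun A d t₀ U ∧ U t₀ = G := by
  classical
  let V : ℕ → Finset (Msg N) := fun n =>
    Nat.rec G (fun n W => W ∪ P.sent A d (t₀ + n) W) n
  refine ⟨fun t => V (t - t₀), ⟨?_, fun t ht m => ?_⟩, ?_⟩
  · simpa [V] using hG
  · obtain ⟨n, rfl⟩ := Nat.exists_eq_add_of_le ht
    rw [show t₀ + n + 1 - t₀ = n + 1 by omega, Nat.add_sub_cancel_left]
    exact Finset.mem_union
  · simp [V]

section Run

variable {A : Finset (Fin N)} {d t₀ : ℕ} {U : ℕ → Finset (Msg N)}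

theorem IsRun.subset_succ (h : P.IsRun A d t₀ U) {t : ℕ} (ht : t₀ ≤ t) : U t ⊆ U (t + 1) :=
  fun m hm => (h.mem_succ t ht m).2 (.inl hm)

theorem IsRun.subset (h : P.IsRun A d t₀ U) {t t' : ℕ} (ht : t₀ ≤ t) (htt : t ≤ t') :
    U t ⊆ U t' := by
  induction t', htt using Nat.le_induction with
  | base => exact subset_rfl
  | succ n hn ih => exact ih.trans (h.subset_succ (ht.trans hn))

theorem IsRun.timely (h : P.IsRun A d t₀ U) {t : ℕ} (ht : t₀ ≤ t) : P.Timely (U t) t := by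
  induction t, ht using Nat.le_induction with
  | base => exact h.timely_start
  | succ n hn ih => exact ih.step (h.subset_succ hn) fun m => (h.mem_succ n hn m).1

theorem IsRun.proposedOn (h : P.IsRun A d t₀ U) {k : ℕ} (hk : 1 ≤ k)
    (ht : t₀ ≤ 2 * (k * P.C)) :
    P.ProposedOn (U (2 * (k * P.C))) k (P.proposal d (k * P.C) (U (2 * (k * P.C)))) := by
  have hT := h.timely ht
  have hpos : 1 ≤ k * P.C := Nat.mul_pos hk P.C_pos
  exact ⟨hT.isView, hT.genesis_mem, fun m hm => (hT.slot_le m hm).trans_lt (by omega),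
    isProposal_proposal _ _ _⟩

/-- If the head of the chain is in `D` whenever all new blocks of the epoch have a parent in `D` and
all its attestations are to blocks in `D`, then this is so throughout the epoch. -/
theorem IsRun.extends (h : P.IsRun A d t₀ U) {k : ℕ} (hk : 1 ≤ k) (ht : t₀ ≤ 2 * (k * P.C))
    (hA : P.proposer (k * P.C) ∈ A) {D : Block N → Prop}
    (hD : ∀ G, P.Extends (U (2 * (k * P.C))) k
      (P.proposal d (k * P.C) (U (2 * (k * P.C)))) D G → D (P.hlmd G))
    {t : ℕ} (h1 : 2 * (k * P.C) + 1 ≤ t) (h2 : t ≤ 2 * ((k + 1) * P.C)) :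
    P.Extends (U (2 * (k * P.C))) k (P.proposal d (k * P.C) (U (2 * (k * P.C)))) D (U t) := by
  have hpos : 1 ≤ k * P.C := Nat.mul_pos hk P.C_pos
  induction t, h1 using Nat.le_induction with
  | base =>
    have hnew : ∀ m ∈ U (2 * (k * P.C) + 1), m ∉ U (2 * (k * P.C)) →
        m = Msg.block (P.proposal d (k * P.C) (U (2 * (k * P.C)))) := fun m hm hmU =>
      (mem_sent_even.1 (((h.mem_succ _ ht m).1 hm).resolve_left hmU)).2
    refine ⟨(h.timely (by omega)).isView, h.subset_succ ht, ?_, fun B hB hBU => ?_,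
      fun α hα hαU => ?_⟩
    · exact (h.mem_succ _ ht _).2 (.inr (mem_sent_even.2 ⟨⟨hpos, hA⟩, rfl⟩))
    · exact .inl (Msg.block_injective (hnew _ hB hBU))
    · exact absurd (hnew _ hα hαU) (by simp)
  | succ t h1 ih =>
    have hE := ih (by omega)
    have hDh := hD _ hE
    have ht' : t₀ ≤ t := by omega
    refine ⟨(h.timely (by omega)).isView, hE.subset.trans (h.subset_succ ht'),
      h.subset_succ ht' hE.mem, fun B hB hBU => ?_, fun α hα hαU => ?_⟩
    · rcases (h.mem_succ t ht' _).1 hB with hB | hB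
      · exact hE.blocks B hB hBU
      · refine .inr ?_
        obtain ⟨i, rfl | rfl⟩ := Nat.even_or_odd' t
        · obtain rfl := Msg.block_injective (mem_sent_even.1 hB).2
          refine ⟨_, hDh, rfl, ?_, ep_eq_iff.2 ?_⟩
          · change _ < i
            omega
          · change _ ≤ i ∧ i < _
            omega
        · obtain ⟨v, _, _, he⟩ := mem_sent_odd.1 hB
          simp at he
    · rcases (h.mem_succ t ht' _).1 hα with hα | hα
      · exact hE.atts α hα hαU
      · obtain ⟨i, rfl | rfl⟩ := Nat.even_or_odd' t
        · simpa using (mem_sent_even.1 hα).2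
        · obtain ⟨v, _, _, he⟩ := mem_sent_odd.1 hα
          obtain rfl : α = P.attestation v i (P.hlmd (U (2 * i + 1))) := by simpa using he
          refine ⟨ep_eq_iff.2 ?_, hDh⟩
          change _ ≤ i ∧ i < _
          omega

-- The index of `v` in the permutation of the epoch, reduced modulo `C`, gives the offset of the
-- slot.
variable (P) in
theorem exists_committee (v : Fin N) (k : ℕ) :
    ∃ i, P.ep i = k ∧ v ∈ P.committee i := by
  set x := (P.ρ k).symm v with hx
  have hlt := Nat.mod_lt (x : ℕ) P.C_pos
  have hep : P.ep (k * P.C + (x : ℕ) % P.C) = k := by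
    rw [ep_eq_iff, Nat.add_mul]
    omega
  refine ⟨k * P.C + (x : ℕ) % P.C, hep, x, ?_, ?_⟩
  · rw [Nat.add_comm, Nat.add_mul_mod_self_right, Nat.mod_mod]
  · rw [hep, hx, Equiv.apply_symm_apply]

/-- The property `D` of heads is chosen so that it persists through the epoch and determines the
checkpoint edge; then all of `A` vote for one edge. This treats both cases of the fork choice at
once. -/
theorem IsRun.epochVotes (h : P.IsRun A d t₀ U) {k : ℕ} (hk : 1 ≤ k) (ht : t₀ ≤ 2 * (k * P.C))
    (hA : P.proposer (k * P.C) ∈ A) (hstake : 2 * (N : ℝ) / 3 < ∑ v ∈ A, P.stake v)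
    {D : Block N → Prop}
    (hD : ∀ G, P.Extends (U (2 * (k * P.C))) k
      (P.proposal d (k * P.C) (U (2 * (k * P.C)))) D G → D (P.hlmd G))
    {q : Pair N} {T : Block N} (hDqT : ∀ B, D B → P.LJ B = q ∧ P.LEBB B = T)
    (hq : P.Justified (U (2 * (k * P.C)) : Set (Msg N)) q) :
    P.EpochVotes (U (2 * ((k + 1) * P.C))) k q T ∧
      T ∈ (P.hlmd (U (2 * ((k + 1) * P.C)))).chain := by
  have hC := P.C_pos
  have hend : 2 * (k * P.C) + 1 ≤ 2 * ((k + 1) * P.C) := by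
    rw [Nat.add_mul]
    omega
  have hE := h.extends hk ht hA hD hend le_rfl
  refine ⟨⟨hq.mono fun _ hα => hE.subset hα, hstake.trans_le ?_, fun α hα hs => ?_⟩, ?_⟩
  · refine Finset.sum_le_sum_of_subset_of_nonneg ?_ fun v _ _ => (P.stake_pos v).le
    intro v hv
    simp only [Finset.mem_filter, Finset.mem_univ, true_and]
    obtain ⟨i, hi, hvi⟩ := P.exists_committee v k
    have hi' := ep_eq_iff.1 hi
    have hDh := hD _ (h.extends hk ht hA hD (t := 2 * i + 1) (by omega) (by omega))
    refine ⟨P.attestation v i (P.hlmd (U (2 * i + 1))), ?_, rfl, (hDqT _ hDh).1, ?_⟩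
    · exact h.subset (t := 2 * i + 1 + 1) (by omega) (by omega)
        ((h.mem_succ (2 * i + 1) (by omega) _).2 (.inr (mem_sent_odd.2 ⟨v, hv, hvi, rfl⟩)))
    · change (P.LEBB _, P.ep i) = _
      rw [(hDqT _ hDh).2, hi]
  · have hαU : Msg.att α ∉ U (2 * (k * P.C)) := fun hαU => by
      have h1 : α.slot < k * P.C := (h.proposedOn hk ht).slot_lt _ hαU
      exact absurd ((ep_eq_iff.1 (rfl : P.ep α.slot = _)).1)
        (not_le.2 (h1.trans_le (Nat.mul_le_mul_right _ hs)))
    obtain ⟨h1, h2⟩ := hE.atts α hα hαU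
    rw [hE.isView.target_eq hα, (hDqT _ h2).2, h1]
  · have h1 := hD _ hE
    rw [← (hDqT _ h1).2]
    exact LEBB_mem_chain _

/-- The validators vote for the new epoch boundary block if its chain contains its last justified
block. -/
theorem IsRun.epochVotes_proposal (h : P.IsRun A d t₀ U) {k : ℕ} (hk : 1 ≤ k)
    (ht : t₀ ≤ 2 * (k * P.C)) (hA : P.proposer (k * P.C) ∈ A)
    (hstake : 2 * (N : ℝ) / 3 < ∑ v ∈ A, P.stake v) {Z : Block N}
    (hZ : P.proposal d (k * P.C) (U (2 * (k * P.C))) = Z) (hJ : (P.LJ Z).1 ∈ Z.chain) :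
    P.EpochVotes (U (2 * ((k + 1) * P.C))) k (P.LJ Z) Z ∧
      Z ∈ (P.hlmd (U (2 * ((k + 1) * P.C)))).chain := by
  subst hZ
  have hP := h.proposedOn hk ht
  exact h.epochVotes hk ht hA hstake (fun G hG => hG.onBranch_hlmd hP hJ)
    (fun B hB => ⟨hB.LJ_eq hP, hB.LEBB_eq⟩) hP.LJ_spec.1

/-- In the bad case the votes go to the edge of the old block `X`. Its target block may be older
than `Z`, but it lies below the head, which is all that the next epoch needs. -/
theorem IsRun.exists_epochVotes (h : P.IsRun A d t₀ U) {k : ℕ} (hk : 1 ≤ k)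
    (ht : t₀ ≤ 2 * (k * P.C)) (hA : P.proposer (k * P.C) ∈ A)
    (hstake : 2 * (N : ℝ) / 3 < ∑ v ∈ A, P.stake v) :
    ∃ q T, P.EpochVotes (U (2 * ((k + 1) * P.C))) k q T ∧
      T ∈ (P.hlmd (U (2 * ((k + 1) * P.C)))).chain := by
  have hP := h.proposedOn hk ht
  set Z := P.proposal d (k * P.C) (U (2 * (k * P.C))) with hZ
  by_cases hJ : (P.LJ Z).1 ∈ Z.chain
  · exact ⟨_, _, h.epochVotes_proposal hk ht hA hstake hZ.symm hJ⟩
  · have hXU := hP.isView.justified_block_mem (fun _ hm => hm) hP.genesis_mem hP.LJ_spec.1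
    refine ⟨_, _, h.epochVotes hk ht hA hstake (D := (· = (P.LJ Z).1))
      (fun G hG => hG.hlmd_eq_of_not_mem hP hJ)
      (fun B hB => ⟨congrArg P.LJ hB, congrArg P.LEBB hB⟩) ?_⟩
    -- The source `LJ X` is justified in the FFG view of `X`, which is part of the common view.
    exact (hP.isView.LJ_spec hXU).1.mono fun _ hα => hP.isView.ffgview_subset hXU hα

/-- The last justified pair of the proposal after an epoch in which everyone voted for `(T, k)`. -/
theorem IsRun.LJ_proposal (h : P.IsRun A d t₀ U) {k : ℕ} (hk : 1 ≤ k)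
    (ht : t₀ ≤ 2 * ((k + 1) * P.C)) {q : Pair N} {T Z : Block N}
    (hv : P.EpochVotes (U (2 * ((k + 1) * P.C))) k q T)
    (hT : T ∈ (P.hlmd (U (2 * ((k + 1) * P.C)))).chain)
    (hZ : P.proposal d ((k + 1) * P.C) (U (2 * ((k + 1) * P.C))) = Z) :
    P.LJ Z = (T, k) ∧ T ∈ Z.chain := by
  subst hZ
  have hP := h.proposedOn (k := k + 1) (by omega) ht
  exact ⟨hv.LJ_eq hk hP, (Block.mem_chain_of_parent hP.parent_eq).2 (.inr hT)⟩

/-- The proposal at an epoch boundary is the head of the chain until the next slot. -/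
theorem IsRun.hlmd_eq_proposal (h : P.IsRun A d t₀ U) {k : ℕ} (hk : 1 ≤ k)
    (ht : t₀ ≤ 2 * (k * P.C)) (hA : P.proposer (k * P.C) ∈ A) {Z : Block N}
    (hZ : P.proposal d (k * P.C) (U (2 * (k * P.C))) = Z) (hJ : (P.LJ Z).1 ∈ Z.chain)
    {G : Finset (Msg N)} (hG : P.IsView G) (h1 : U (2 * (k * P.C) + 1) ⊆ G)
    (h2 : G ⊆ U (2 * (k * P.C) + 1 + 1)) : P.hlmd G = Z := by
  subst hZ
  have hP := h.proposedOn hk ht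
  have hC := P.C_pos
  have hmul : (k + 1) * P.C = k * P.C + P.C := Nat.succ_mul _ _
  have hE₁ := h.extends hk ht hA (fun G hG => hG.onBranch_hlmd hP hJ)
    (t := 2 * (k * P.C) + 1) le_rfl (by omega)
  have hE₂ := h.extends hk ht hA (fun G hG => hG.onBranch_hlmd hP hJ)
    (t := 2 * (k * P.C) + 1 + 1) (by omega) (by omega)
  have hE : P.Extends (U (2 * (k * P.C))) k (P.proposal d (k * P.C) (U (2 * (k * P.C))))
      (P.OnBranch (P.proposal d (k * P.C) (U (2 * (k * P.C)))) k) G :=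
    ⟨hG, hE₁.subset.trans h1, h1 hE₁.mem, fun B hB => hE₂.blocks B (h2 hB),
      fun α hα => hE₂.atts α (h2 hα)⟩
  have hb := hE.onBranch_hlmd hP hJ
  have hm := hG.hlmd_mem (hE.subset hP.genesis_mem)
  -- A block above `Z` other than `Z` would have a slot later than `k * C`, too late for this view.
  rcases hE.blocks _ hm fun hU => hP.not_mem_chain hU hb.1 with he | ⟨_, _, _, hs, _⟩
  · exact he
  · have h3 : (P.hlmd G).slot ≤ _ := (h.timely (by omega)).slot_le _ (h2 hm)
    omega

/-! ### Executions -/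

variable (P) in
/-- In the state `σ`, the validators in `A` can have the common view `U σ.time`. -/
structure Synced (A : Finset (Fin N)) (U : ℕ → Finset (Msg N)) (σ : State N) : Prop where
  timely : ∀ v, P.Timely (σ.view v) σ.time
  view_net : ∀ v, σ.view v ⊆ σ.net
  common_net : U σ.time ⊆ σ.net
  view_common : ∀ v ∈ A, σ.view v ⊆ U σ.time

/-- Before acting, each validator in `A` receives the whole common view; he adds his own message at
once, and those of the others arrive in the next step. Validators outside `A` receive nothing. -/
theorem IsRun.exists_step (h : P.IsRun A d t₀ U) {σ : State N} (hσ : P.Synced A U σ)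
    (ht : t₀ ≤ σ.time) : ∃ σ', P.Step A A σ σ' ∧ P.Synced A U σ' ∧ σ'.time = σ.time + 1 ∧
      ∀ v ∈ A, U σ.time ⊆ σ'.view v := by
  classical
  set S := P.sent A d σ.time (U σ.time) with hS
  let W : Fin N → Finset (Msg N) := fun v =>
    if v ∈ A then U σ.time ∪ S.filter (fun m => m.author = some v) else σ.view v
  have hWA : ∀ v ∈ A, ∀ m, m ∈ W v ↔ m ∈ U σ.time ∨ m ∈ S.filter (fun m => m.author = some v) :=
    fun v hv m => by simp only [W, if_pos hv, Finset.mem_union]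
  have hW : ∀ v, v ∉ A → W v = σ.view v := fun v hv => if_neg hv
  have htW : ∀ v, P.Timely (W v) (σ.time + 1) := fun v => by
    by_cases hv : v ∈ A
    · refine (h.timely ht).step (A := A) (d := d) (fun m hm => (hWA v hv m).2 (.inl hm))
        fun m hm => ((hWA v hv m).1 hm).imp_right fun hm => (Finset.mem_filter.1 hm).1
    · rw [hW v hv]
      exact (hσ.timely v).mono (Nat.le_succ _)
  have hsub : ∀ v, σ.view v ⊆ W v := fun v => by
    by_cases hv : v ∈ A
    · exact fun m hm => (hWA v hv m).2 (.inl (hσ.view_common v hv hm))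
    · rw [hW v hv]
  have hnet : ∀ v, W v ⊆ σ.net ∪ S := fun v => by
    by_cases hv : v ∈ A
    · intro m hm
      rcases (hWA v hv m).1 hm with hm | hm
      · exact Finset.mem_union_left _ (hσ.common_net hm)
      · exact Finset.mem_union_right _ (Finset.mem_filter.1 hm).1
    · rw [hW v hv]
      exact (hσ.view_net v).trans Finset.subset_union_left
  refine ⟨⟨σ.time + 1, σ.net ∪ S, W⟩, ⟨S, ⟨rfl, fun m => Finset.mem_union, hsub, hnet,
    fun v => (htW v).isView, fun v m hm => (htW v).slot_le m hm⟩, fun v hv => ?_,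
    fun m hm v hv => .inl (author_of_mem_sent hm hv)⟩, ⟨htW, hnet, fun m hm => ?_,
    fun v hv m hm => ?_⟩, rfl, fun v hv m hm => (hWA v hv m).2 (.inl hm)⟩
  · exact ⟨U σ.time, S.filter (fun m => m.author = some v), hσ.view_common v hv, hσ.common_net,
      (h.timely ht).isView, prescribed_sent hv fun m => Finset.mem_filter,
      fun m => Finset.mem_filter, hWA v hv⟩
  · rcases (h.mem_succ _ ht m).1 hm with hm | hm
    · exact Finset.mem_union_left _ (hσ.common_net hm)
    · exact Finset.mem_union_right _ hm
  · exact (h.mem_succ _ ht m).2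
      (((hWA v hv m).1 hm).imp_right fun hm => (Finset.mem_filter.1 hm).1)

theorem IsRun.exists_execution (h : P.IsRun A d t₀ U) {σ : State N} (hσ : P.Synced A U σ)
    (ht : t₀ ≤ σ.time) {t : ℕ} (htt : σ.time ≤ t) :
    ∃ σ', P.Execution A A σ σ' ∧ P.Synced A U σ' ∧ σ'.time = t + 1 ∧
      ∀ v ∈ A, U t ⊆ σ'.view v := by
  induction t, htt using Nat.le_induction with
  | base =>
    obtain ⟨σ', h1, h2, h3, h4⟩ := h.exists_step hσ ht
    exact ⟨σ', .single h1, h2, h3, h4⟩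
  | succ t htt ih =>
    obtain ⟨τ, e1, e2, e3, -⟩ := ih
    obtain ⟨σ', h1, h2, h3, h4⟩ := h.exists_step e2 (by omega)
    rw [e3] at h3 h4
    exact ⟨σ', e1.tail h1, h2, h3, h4⟩

end Run

-- Finalization from an arbitrary state

theorem Possible.timely {s : State N} (hs : P.Possible s) :
    ∀ v, P.Timely (s.view v) s.time ∧ s.view v ⊆ s.net := by
  induction hs with
  | refl =>
    refine fun v => ⟨⟨⟨fun m hm => ?_, fun m hm m' hd => ?_⟩, ?_, fun m hm => ?_⟩, subset_rfl⟩
    · obtain rfl := Finset.mem_singleton.1 hm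
      intro p hp
      simp [Block.parent] at hp
    · obtain rfl := Finset.mem_singleton.1 hm
      cases hd with
      | parent h => simp [Block.parent] at h
      | newattest h => simp [Block.newattests] at h
    · exact Finset.mem_singleton_self _
    · obtain rfl := Finset.mem_singleton.1 hm
      exact Nat.zero_le _
  | tail _ hstep ih =>
    obtain ⟨sent, hn, -⟩ := hstep
    refine fun v => ⟨⟨hn.view_isView v, hn.view_mono v (ih v).1.genesis_mem, fun m hm => ?_⟩,
      hn.view_net v⟩
    rw [hn.time_eq, Nat.add_sub_cancel]
    exact hn.view_slot v m hm

theorem Step.mono {H A : Finset (Fin N)} (hHA : H ⊆ A) {s s' : State N} (h : P.Step A A s s') :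
    P.Step H A s s' := by
  obtain ⟨sent, hn, hf, ha⟩ := h
  exact ⟨sent, hn, fun v hv => hf v (hHA hv), fun m hm v hv => .inr ((ha m hm v hv).elim id id)⟩

/-- Validators in `A` but not in `H` may behave arbitrarily, so in particular they may follow the
protocol. -/
theorem CanFinalize.mono {H A : Finset (Fin N)} (hHA : H ⊆ A) {s : State N}
    (h : P.CanFinalize A A s) : P.CanFinalize H A s := by
  obtain ⟨s₁, s₂, e, B, h1, h2, h3, h4, h5, h6, h7, h8, h9, h10, h11⟩ := h
  exact ⟨s₁, s₂, e, B, Relation.ReflTransGen.mono (fun _ _ => Step.mono hHA) _ _ h1,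
    Relation.ReflTransGen.mono (fun _ _ => Step.mono hHA) _ _ h2, h3, h4, h5, h6, h7,
    fun v hv => h8 v (hHA hv), h9, h10, fun v hv => h11 v (hHA hv)⟩

/-- Putting unused data into all proposals guarantees that the finalized block is new. -/
theorem exists_fresh_data (F : Finset (Msg N)) :
    ∃ d, ∀ v i p l, Msg.block (Block.mk v i p l d) ∉ F := by
  classical
  let f : Msg N → ℕ := fun m => match m with
    | .block (.mk _ _ _ _ d) => d
    | _ => 0
  obtain ⟨d, hd⟩ := Infinite.exists_notMem_finset (F.image f)
  exact ⟨d, fun v i p l h => hd (Finset.mem_image.2 ⟨_, h, rfl⟩)⟩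

/-- Plausible liveness if all validators in `A` follow the protocol. -/
theorem Possible.canFinalize {s : State N} (hs : P.Possible s) {A : Finset (Fin N)}
    (hstake : 2 * (N : ℝ) / 3 < ∑ v ∈ A, P.stake v)
    (hA : ∀ k ∈ Finset.Icc 1 3, P.proposer ((P.ep s.slot + k) * P.C) ∈ A) :
    P.CanFinalize A A s := by
  classical
  have hC := P.C_pos
  have hview := hs.timely
  -- The initial common view pools the views of all validators, including those outside `A`; every
  -- message in it has been broadcast and accepted by someone.
  have hG : P.Timely (Finset.univ.biUnion s.view) s.time := by
    refine ⟨⟨fun m hm => ?_, fun m hm m' hd => ?_⟩, ?_, fun m hm => ?_⟩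
    · obtain ⟨v, -, hv⟩ := Finset.mem_biUnion.1 hm
      exact (hview v).1.isView.1 m hv
    · obtain ⟨v, hv, hm⟩ := Finset.mem_biUnion.1 hm
      exact Finset.mem_biUnion.2 ⟨v, hv, (hview v).1.isView.2 m hm m' hd⟩
    · exact Finset.mem_biUnion.2
        ⟨⟨0, P.N_pos⟩, Finset.mem_univ _, (hview _).1.genesis_mem⟩
    · obtain ⟨v, -, hv⟩ := Finset.mem_biUnion.1 hm
      exact (hview v).1.slot_le m hv
  obtain ⟨d, hd⟩ := exists_fresh_data s.net
  obtain ⟨U, hU, hU₀⟩ := P.exists_isRun A d hG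
  have hsync : P.Synced A U s := by
    refine ⟨fun v => (hview v).1, fun v => (hview v).2, ?_, fun v _ => ?_⟩
    · rw [hU₀]
      exact Finset.biUnion_subset.2 fun v _ => (hview v).2
    · rw [hU₀]
      exact Finset.subset_biUnion_of_mem s.view (Finset.mem_univ v)
  obtain ⟨k, hk⟩ : ∃ k, k = P.ep s.slot := ⟨_, rfl⟩
  rw [← hk] at hA
  have hslot := ep_eq_iff.1 hk.symm
  have htime : s.time ≤ 2 * s.slot + 1 := by
    rw [State.slot]
    omega
  have m1 : (k + 1) * P.C = k * P.C + P.C := Nat.succ_mul _ _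
  have m2 : (k + 2) * P.C = k * P.C + 2 * P.C := Nat.add_mul _ _ _
  have m3 : (k + 3) * P.C = k * P.C + 3 * P.C := Nat.add_mul _ _ _
  have m2' : (k + 1 + 1) * P.C = k * P.C + 2 * P.C := Nat.add_mul k 2 _
  have m3' : (k + 2 + 1) * P.C = k * P.C + 3 * P.C := Nat.add_mul k 3 _
  have m4 : (k + 2 + 2) * P.C = k * P.C + 4 * P.C := Nat.add_mul k 4 _
  have m4' : (k + 3 + 1) * P.C = k * P.C + 4 * P.C := Nat.add_mul k 4 _
  -- Epoch `k + 1` is the first to start after the current slot. Either case of the fork choice may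
  -- occur in it; from epoch `k + 2` on only the good one does.
  obtain ⟨q, T, hv₁, hT₁⟩ := hU.exists_epochVotes (k := k + 1) (by omega) (by omega)
    (hA 1 (by simp)) hstake
  obtain ⟨B, hB⟩ : ∃ B, P.proposal d ((k + 2) * P.C) (U (2 * ((k + 2) * P.C))) = B := ⟨_, rfl⟩
  obtain ⟨hJ, hTB⟩ := hU.LJ_proposal (k := k + 1) (by omega) (by omega) hv₁ hT₁ hB
  obtain ⟨hv₂, hB₂⟩ := hU.epochVotes_proposal (k := k + 2) (by omega) (by omega)
    (hA 2 (by simp)) hstake hB (hJ ▸ hTB)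
  obtain ⟨B', hB'⟩ : ∃ B', P.proposal d ((k + 3) * P.C) (U (2 * ((k + 3) * P.C))) = B' := ⟨_, rfl⟩
  obtain ⟨hJ', hBB'⟩ := hU.LJ_proposal (k := k + 2) (by omega) (by omega) hv₂ hB₂ hB'
  obtain ⟨hv₃, hB₃⟩ := hU.epochVotes_proposal (k := k + 3) (by omega) (by omega)
    (hA 3 (by simp)) hstake hB' (hJ' ▸ hBB')
  have hP : P.ProposedOn _ (k + 2) B := hB ▸ hU.proposedOn (k := k + 2) (by omega) (by omega)
  have hP' : P.ProposedOn _ (k + 3) B' := hB' ▸ hU.proposedOn (k := k + 3) (by omega) (by omega)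
  -- This runs through the attestations in the slot of `B`, that is, to the end of this slot.
  obtain ⟨s₁, x₁, y₁, z₁, w₁⟩ := hU.exists_execution hsync le_rfl
    (t := 2 * ((k + 2) * P.C) + 1) (by omega)
  -- At the first event of epoch `k + 4` everyone in `A` receives the common view, with all votes of
  -- epoch `k + 3`.
  obtain ⟨s₂, x₂, -, z₂, w₂⟩ := hU.exists_execution y₁ (by omega)
    (t := 2 * ((k + 3 + 1) * P.C)) (by omega)
  refine ⟨s₁, s₂, k + 2, B, x₁, x₂, ?_, hP.slot_eq, by omega, by omega, by omega,
    fun v hv => ?_, ?_, by omega, fun v hv => ?_⟩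
  · rw [← hB]
    exact hd _ _ _ _
  · refine hU.hlmd_eq_proposal (k := k + 2) (by omega) (by omega) (hA 2 (by simp)) hB (hJ ▸ hTB)
      (y₁.timely v).isView (w₁ v hv) ?_
    rw [← z₁]
    exact y₁.view_common v hv
  · refine ⟨T, k + 1, rfl, ?_⟩
    rw [hP.EBB_eq le_rfl, hJ]
  · have hend := hU.timely (t := 2 * ((k + 3 + 1) * P.C)) (by omega)
    have hBmem := hend.isView.mem_of_mem_chain (hend.isView.hlmd_mem hend.genesis_mem) hB₃
    have hfin : P.KFinalized (s₂.view v) 1 (B, k + 2) := by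
      refine ⟨le_rfl, fun i => if i = 0 then B else B', rfl, fun i h1 h2 => ?_, fun i hi => ?_,
        fun i hi => ?_, ?_⟩
      · obtain rfl : i = 1 := le_antisymm h2 h1
        exact w₂ v hv hBmem
      · interval_cases i
        -- `B` is in the chain of `B'`, and its slot is exactly the boundary of epoch `k + 2`.
        · have := hend.isView.lastUpTo_slot_eq hBmem hBB'
          rwa [hP.slot_eq] at this
        · exact hP'.EBB_eq le_rfl
      · obtain rfl : i = 0 := by omega
        refine hv₂.justified_target.mono fun α hα => w₂ v hv ?_
        exact hU.subset (by omega) (by omega) hα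
      · have hl := hv₃.link
        rw [hJ'] at hl
        exact hl.mono fun α hα => w₂ v hv hα
    exact ⟨hfin, .inr ⟨1, hfin⟩⟩

end Params

end Gasper

theorem theorem2 {N : ℕ} (P : Gasper.Params N) (H : Finset (Fin N))
    (hH : 2 * (N : ℝ) / 3 ≤ ∑ v ∈ H, P.stake v)
    (s : Gasper.State N) (hs : P.Possible s) :
    P.CanFinalize H Finset.univ s ∧
    ∀ A : Finset (Fin N),
      (H ⊂ A ∨ (H = A ∧ 2 * (N : ℝ) / 3 < ∑ v ∈ H, P.stake v)) →
      (∀ k ∈ Finset.Icc 1 3, P.proposer ((P.ep s.slot + k) * P.C) ∈ A) →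
      P.CanFinalize H A s := by
  constructor
  · refine Gasper.Params.CanFinalize.mono (Finset.subset_univ H)
      (hs.canFinalize ?_ fun _ _ => Finset.mem_univ _)
    rw [P.stake_sum]
    have : (0 : ℝ) < N := Nat.cast_pos.2 P.N_pos
    linarith
  · rintro A (hHA | ⟨rfl, hlt⟩) hA
    -- The positive stake of one more validator makes the bound `2N/3` strict.
    · obtain ⟨v, hvA, hvH⟩ := Finset.exists_of_ssubset hHA
      refine Gasper.Params.CanFinalize.mono hHA.1 (hs.canFinalize (hH.trans_lt ?_) hA)
      exact Finset.sum_lt_sum_of_subset hHA.1 hvA hvH (P.stake_pos v)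
        fun w _ _ => (P.stake_pos w).le
    · exact hs.canFinalize hlt hA
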